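/- Let $n, r$ be positive integers. An $r$-colored permutation of $[m]=\{1,\dots,m\}$ is a pair $w = (\sigma, \varepsilon)$ with $\sigma \in \mathfrak{S}_m$ and $\varepsilon = (\varepsilon_1,\dots,\varepsilon_m) \in \{0,1,\dots,r-1\}^m$; the set of all of them is denoted by $\mathbb{Z}_r \wr \mathfrak{S}_m$. An index $k \in [m]$ is a descent of $w$ if $\varepsilon_k > \varepsilon_{k+1}$, or $\varepsilon_k = \varepsilon_{k+1}$ and $\sigma(k) > \sigma(k+1)$, where $\sigma(m+1) := m+1$ and $\varepsilon_{m+1} := 0$; otherwise $k$ is an ascent. The set of ascents of $w$ is $\mathrm{Asc}(w) \subseteq [m]$ and the number of descents is $\mathrm{des}(w)$. Set $\mathrm{fexc}(w) := r \cdot \#\{k \in [m] : \sigma(k) > k,\ \varepsilon_k = 0\} + \varepsilon_1 + \cdots + \varepsilon_m$. For $m \ge 1$ let $d^+_{m,r}(t) := \sum_{i=1}^{\lfloor m/2 \rfloor} \xi^+_{m,r,i}\, t^i (1+t)^{m-2i}$, where $\xi^+_{m,r,i}$ is the number of $w \in \mathbb{Z}_r \wr \mathfrak{S}_m$ such that $\mathrm{Asc}(w)$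 is contained in $\{2,\dots,m\}$, has exactly $i$ elements, no two of them consecutive, and contains $m$. Let $d^+_{0,r}(t) := 1$ and $$A^+_{n,r}(t) := \sum_{k=0}^n \binom{n}{k} d^+_{k,r}(t).$$ The $h$-polynomial of a $(d-1)$-dimensional finite simplicial complex $\Delta$ is $h(\Delta,t) := \sum_{i=0}^d f_{i-1}(\Delta)\, t^i (1-t)^{d-i}$, where $f_{i-1}(\Delta)$ is the number of faces of $\Delta$ with exactly $i$ vertices (so that $f_{-1}(\Delta)=1$). If the vertices of $\Delta$ are linearly ordered as $v_1, \dots, v_m$, the $r$-fold edgewise subdivision $\mathrm{esd}_r(\Delta)$ is the simplicial complex whose vertices are the maps $f : \{v_1,\dots,v_m\} \to \mathbb{N}$ with $\sum_j f(v_j) = r$ whose support $\mathrm{supp}(f) = \{v_j : f(v_j) \neq 0\}$ is a face of $\Delta$; a set $E$ of such maps is a face if $\bigcup_{f \in E} \mathrm{supp}(f) \in \Delta$ and, for all $f, g \in E$, either $\iota(f) - \iota(g)$ or $\iota(g) - \iota(f)$ takes all its values in $\{0,1\}$, where $\iota(f)(v_j) := f(v_1) + \cdots + f(v_j)$. Let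 $\Gamma_n$ be the barycentric subdivision of the $(n-1)$-dimensional simplex, i.e. the simplicial complex of all chains, with respect to inclusion, of nonempty subsets of $[n]$. Let $\Gamma_{n,r} := \mathrm{esd}_r(\Gamma_n)$, defined with respect to an arbitrary linear order on the vertices of $\Gamma_n$. Then, for all positive integers $n, r$: (a) $A^+_{n,r}(t) = h(\Gamma_{n,r}, t)$, for every choice of the linear order on the vertices of $\Gamma_n$. (b) As formal power series in $t$, $$\frac{A^+_{n,r}(t)}{(1-t)^n} = \sum_{k \ge 0} \left( (rk+1)^n - (rk)^n \right) t^k.$$ (c) $$A^+_{n,r}(t) = \sum_{w \in (\mathbb{Z}_r \wr \mathfrak{S}_n)^+} t^{\mathrm{des}(w)} = \sum_{w \in (\mathbb{Z}_r \wr \mathfrak{S}_n)^b} t^{\mathrm{fexc}(w)/r},$$ where $(\mathbb{Z}_r \wr \mathfrak{S}_n)^+$ is the set of $w = (\sigma,\varepsilon) \in \mathbb{Z}_r \wr \mathfrak{S}_n$ with $\varepsilon_1 = 0$, and $(\mathbb{Z}_r \wr \mathfrak{S}_n)^b$ is the set of those $w$ for which $\varepsilon_1 + \cdots + \varepsilon_n$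 is divisible by $r$. -/

import Mathlib

open Polynomial

/-- An `r`-colored permutation of `[n]`, i.e. an element of `ℤ_r ≀ 𝔖_n`, written as a pair `(σ, ε)`
of a permutation and a vector of colors; `ε k` is the color assigned to `σ k`.
Positions and values are indexed by `0, …, n - 1` instead of `1, …, n`. -/
abbrev ColoredPerm (n r : ℕ) : Type := Equiv.Perm (Fin n) × (Fin n → Fin r)

namespace ColoredPerm

variable {n r : ℕ}

/-- The value `σ (k + 1)`, with the convention that the value following the last one is larger than
all values of `σ` (it is `n` in the indexing from zero, i.e. `σ(n+1) = n+1` in the usual one). -/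
def nextValue (w : ColoredPerm n r) (k : Fin n) : ℕ :=
  if h : (k : ℕ) + 1 < n then (w.1 ⟨(k : ℕ) + 1, h⟩ : ℕ) else n

/-- The color `ε (k + 1)`, with the convention that the color following the last one is `0`. -/
def nextColor (w : ColoredPerm n r) (k : Fin n) : ℕ :=
  if h : (k : ℕ) + 1 < n then (w.2 ⟨(k : ℕ) + 1, h⟩ : ℕ) else 0

/-- The descent set `Des(w)`. -/
def Des (w : ColoredPerm n r) : Finset (Fin n) :=
  Finset.univ.filter fun k =>
    w.nextColor k < (w.2 k : ℕ) ∨ ((w.2 k : ℕ) = w.nextColor k ∧ w.nextValue k < (w.1 k : ℕ))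

/-- The ascent set `Asc(w)`: the complement of the descent set in the set of all `n` positions. -/
def Asc (w : ColoredPerm n r) : Finset (Fin n) := Finset.univ \ w.Des

/-- The number of descents. -/
def des (w : ColoredPerm n r) : ℕ := w.Des.card

/-- The number of positions `k` with `σ k > k` and `ε k = 0`. -/
def excA (w : ColoredPerm n r) : ℕ :=
  (Finset.univ.filter fun k : Fin n => k < w.1 k ∧ (w.2 k : ℕ) = 0).card

/-- The sum of all colors, as a natural number. -/
def colorSum (w : ColoredPerm n r) : ℕ := ∑ k, (w.2 k : ℕ)

/-- The flag excedance number. -/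
def fexc (w : ColoredPerm n r) : ℕ := r * w.excA + w.colorSum

/-- The first coordinate has zero color. -/
def FirstColorZero (w : ColoredPerm n r) : Prop := ∀ k : Fin n, (k : ℕ) = 0 → (w.2 k : ℕ) = 0

/-- `Asc(w)` does not contain the first position, contains the last position, has exactly `i`
elements, and no two of them are consecutive. -/
def AscCondition (i : ℕ) (w : ColoredPerm n r) : Prop :=
  (∀ k ∈ w.Asc, (k : ℕ) ≠ 0) ∧ (∃ k ∈ w.Asc, (k : ℕ) + 1 = n) ∧ w.Asc.card = i ∧
    ∀ j ∈ w.Asc, ∀ k ∈ w.Asc, (k : ℕ) ≠ (j : ℕ) + 1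

instance : DecidablePred (FirstColorZero : ColoredPerm n r → Prop) := fun _ =>
  inferInstanceAs (Decidable (∀ _, _))

instance (i : ℕ) : DecidablePred (AscCondition i : ColoredPerm n r → Prop) := fun _ =>
  inferInstanceAs (Decidable (_ ∧ _))

end ColoredPerm

/-- The number `ξ⁺_{n,r,i}` of `w ∈ ℤ_r ≀ 𝔖_n` such that `Asc(w) ⊆ [2, n]` has exactly `i`
elements, no two consecutive, and contains `n` (positions numbered from `1`). -/
def xiPlus (n r i : ℕ) : ℕ :=
  (Finset.univ.filter fun w : ColoredPerm n r => w.AscCondition i).card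

/-- The polynomial `d⁺_{n,r}(t)`, equal to `1` for `n = 0`. -/
noncomputable def dPlus (n r : ℕ) : ℤ[X] :=
  if n = 0 then 1
  else ∑ i ∈ Finset.Icc 1 (n / 2), (xiPlus n r i : ℤ[X]) * X ^ i * (1 + X) ^ (n - 2 * i)

/-- The polynomial `A⁺_{n,r}(t) = ∑_{k=0}^n (n choose k) d⁺_{k,r}(t)`. -/
noncomputable def APlus (n r : ℕ) : ℤ[X] :=
  ∑ k ∈ Finset.range (n + 1), (n.choose k : ℤ[X]) * dPlus k r

namespace AbstractSimplicialComplex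

variable {V : Type*}

/-- The number of faces with `i` vertices, i.e. `f_{i-1}`. The empty face, which is not listed
among the faces of an `AbstractSimplicialComplex`, is counted, so that `f_{-1} = 1`. -/
noncomputable def faceCount (K : AbstractSimplicialComplex V) (i : ℕ) : ℕ :=
  {s : Finset V | (s = ∅ ∨ s ∈ K.faces) ∧ s.card = i}.ncard

/-- The largest number of vertices of a face, i.e. the dimension plus one
(for complexes whose faces have bounded size). -/
noncomputable def rank (K : AbstractSimplicialComplex V) : ℕ :=
  sSup {m : ℕ | ∃ s ∈ K.faces, s.card = m}

/-- The `h`-polynomial `∑_{i=0}^d f_{i-1} t^i (1 - t)^{d-i}` of a simplicial complex of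
dimension `d - 1` with finitely many faces. -/
noncomputable def hPolynomial (K : AbstractSimplicialComplex V) : ℤ[X] :=
  ∑ i ∈ Finset.range (K.rank + 1), (K.faceCount i : ℤ[X]) * X ^ i * (1 - X) ^ (K.rank - i)

section Edgewise

variable [Fintype V]

/-- The support of a map `f : V → ℕ`. -/
def supp (f : V → ℕ) : Finset V := Finset.univ.filter fun v => f v ≠ 0

/-- The partial sums `ι(f)(v) = ∑_{u ≤ v} f(u)` of a map `f : V → ℕ` on a linearly ordered set. -/
def partialSum (L : LinearOrder V) (f : V → ℕ) (v : V) : ℕ :=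
  ∑ u ∈ Finset.univ.filter (fun u => u ≤ v), f u

/-- The vertex set of the `r`-fold edgewise subdivision: maps `V → ℕ` with sum `r` whose support is
a face. -/
def EdgewiseVertex (K : AbstractSimplicialComplex V) (r : ℕ) : Type _ :=
  {f : V → ℕ // supp f ∈ K.faces ∧ ∑ v, f v = r}

/-- The `r`-fold edgewise subdivision of `K` with respect to the linear order `L` on the vertices. A
nonempty set `E` of vertices is a face if the union of all supports is a face of `K` and, for all
`f, g ∈ E`, one of the differences `ι(f) - ι(g)`, `ι(g) - ι(f)` takes values in `{0, 1}`. -/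
def edgewise (K : AbstractSimplicialComplex V) (L : LinearOrder V) (r : ℕ) :
    AbstractSimplicialComplex (EdgewiseVertex K r) where
  faces := {E | E.Nonempty ∧ E.biUnion (fun f => supp f.1) ∈ K.faces ∧
    ∀ f ∈ E, ∀ g ∈ E,
      (∀ v, (partialSum L f.1 v : ℤ) - partialSum L g.1 v ∈ ({0, 1} : Set ℤ)) ∨
      (∀ v, (partialSum L g.1 v : ℤ) - partialSum L f.1 v ∈ ({0, 1} : Set ℤ))}
  isRelLowerSet_faces := by
    rintro E ⟨hE, hU, hd⟩
    refine ⟨hE, fun E' hsub hE' => ⟨hE', ?_, fun f hf g hg => hd f (hsub hf) g (hsub hg)⟩⟩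
    refine (K.isRelLowerSet_faces hU).2 (Finset.biUnion_subset_biUnion_of_subset_left _ hsub) ?_
    obtain ⟨f, hf⟩ := hE'
    obtain ⟨v, hv⟩ := (K.isRelLowerSet_faces f.2.1).1
    exact ⟨v, Finset.mem_biUnion.2 ⟨f, hf, hv⟩⟩
  singleton_mem f := by
    refine ⟨Finset.singleton_nonempty f, ?_, ?_⟩
    · rw [Finset.singleton_biUnion]
      exact f.2.1
    · intro g hg h hh
      rw [Finset.mem_singleton] at hg hh
      subst hg hh
      exact Or.inl fun v => by simp

end Edgewise

end AbstractSimplicialComplex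

/-- The nonempty faces of the simplex on the vertex set `{0, …, n - 1}`, i.e. its nonempty
subsets. -/
def SimplexFace (n : ℕ) : Type := {s : Finset (Fin n) // s.Nonempty}

instance (n : ℕ) : Fintype (SimplexFace n) :=
  inferInstanceAs (Fintype {s : Finset (Fin n) // s.Nonempty})

/-- The barycentric subdivision `Γ_n` of the `(n - 1)`-dimensional simplex: the complex of chains
of nonempty subsets of an `n`-element set. -/
def barycentricSimplex (n : ℕ) : AbstractSimplicialComplex (SimplexFace n) where
  faces := {C | C.Nonempty ∧ ∀ s ∈ C, ∀ t ∈ C, s.1 ⊆ t.1 ∨ t.1 ⊆ s.1}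
  isRelLowerSet_faces := by
    rintro C ⟨hC, hc⟩
    exact ⟨hC, fun D hD hne => ⟨hne, fun s hs t ht => hc s (hD hs) t (hD ht)⟩⟩
  singleton_mem s := by
    refine ⟨Finset.singleton_nonempty s, fun a ha b hb => ?_⟩
    rw [Finset.mem_singleton] at ha hb
    subst ha hb
    exact Or.inl subset_rfl

/-- The triangulation `Γ_{n,r}`: the `r`-fold edgewise subdivision of the barycentric subdivision of
the `(n - 1)`-dimensional simplex, with respect to a linear order `L` on the vertices of the
latter. -/
def edgewiseBarycentric (n r : ℕ) (L : LinearOrder (SimplexFace n)) :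
    AbstractSimplicialComplex ((barycentricSimplex n).EdgewiseVertex r) :=
  (barycentricSimplex n).edgewise L r

/-! Everything is compared, inside ℚ⟦t⟧, with E_n = (1-t)^n Σ_k ((rk+1)^n - (rk)^n) t^k, corrected
to 1 for n = 0 (`eulerianSeries`). Summing geometric series, its exponential generating function in
x is (e^{(1-t)x} - t e^{(1-t)rx}) / (1 - t e^{(1-t)rx}). This characterizes the sequence
(`HasEulerianEGF.unique`).

For A⁺ and for the descent sum, colored permutations become words of colored letters, and one cuts
off monotone prefixes. There are |C|^|S| monotone words with value set S and colors in C, so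
weighting a prefix of length i by a^i multiplies the generating function by e^{a|C|x}
(`sum_words_prefixSum`). For suitable a the prefix sums cancel word by word, except on monotone
words with restricted colors (`desWeight_sub_prefixSum`, `prefixSum_gammaWeight`), or leave only the
words with first color zero (`desWeight_sub_prefixSum_nonzeroColors`). With B, E, D the generating
functions of all descents, of descents with first color zero, and of d⁺, this gives B (1 - t
e^{(1-t)rx}) = (1-t) e^{(1-t)x}, (1-t) E = B (1 - t e^{(1-t)(r-1)x}), D (e^{trx} - t e^{rx}) =
e^{t(r-1)x} - t e^{(r-1)x}. The generating function of A⁺ is e^x D.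

For flag excedances, Σ_w t^{fexc w} = (1 + … + t^{r-1})^n Σ_σ t^{exc σ}. The Eulerian identity Σ_σ
t^{exc σ} = (1-t)^{n+1} Σ_k (k+1)^n t^k, followed by extraction of the exponents divisible by r,
yields E_n.

For the h-polynomial, h(Δ,t)/(1-t)^d is the series counting ℕ-valued maps supported on faces
(`hilbertSeries_mul`). Maps of sum k on esd_r(Δ) biject with maps of sum rk on Δ
(`ncard_supportedMaps_edgewise`), and on Γ_n there are (k+1)^n - k^n maps of sum k
(`ncard_supportedMaps_barycentricSimplex`). The dimension need not be computed: neither numerator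
vanishes at t = 1, so the pole order determines it. -/

theorem C_one_sub_ne_zero {R : Type*} [CommRing R] {t : R} (ht : t ≠ 1) : (PowerSeries.C (1 - t) : PowerSeries R) ≠ 0 := by
  intro h
  have h0 := congrArg (PowerSeries.coeff 0) h
  simp only [PowerSeries.coeff_C, if_true, map_zero] at h0
  exact ht (sub_eq_zero.1 h0).symm

/-! ### Exponential generating functions and the characterizing equation. -/

section ExponentialGeneratingFunctions

variable {R : Type*} [CommRing R] [Algebra ℚ R]

/-- The exponential generating function of a sequence. -/
noncomputable def egf (u : ℕ → R) : PowerSeries R :=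
  PowerSeries.mk fun n => algebraMap ℚ R (1 / n.factorial) * u n

theorem egf_injective : Function.Injective (egf : (ℕ → R) → PowerSeries R) := by
  intro u v h
  funext n
  have h1 := congrArg (PowerSeries.coeff n) h
  simp only [egf, PowerSeries.coeff_mk] at h1
  have h2 : algebraMap ℚ R (n.factorial) * algebraMap ℚ R (1 / n.factorial) = 1 := by
    rw [← map_mul, mul_one_div_cancel (by exact_mod_cast n.factorial_ne_zero), map_one]
  calc u n = algebraMap ℚ R (n.factorial) * (algebraMap ℚ R (1 / n.factorial) * u n) := by
        rw [← mul_assoc, h2, one_mul]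
    _ = v n := by rw [h1, ← mul_assoc, h2, one_mul]

theorem egf_mul (u v : ℕ → R) :
    egf u * egf v = egf fun n => ∑ k ∈ Finset.range (n + 1), (n.choose k : R) * (u k * v (n - k)) := by
  ext n
  rw [PowerSeries.coeff_mul, Finset.Nat.sum_antidiagonal_eq_sum_range_succ
    (fun i j => PowerSeries.coeff i (egf u) * PowerSeries.coeff j (egf v))]
  simp only [egf, PowerSeries.coeff_mk, Finset.mul_sum]
  refine Finset.sum_congr rfl fun k hk => ?_
  have hk' : k ≤ n := Nat.lt_succ_iff.1 (Finset.mem_range.1 hk)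
  have h : algebraMap ℚ R (1 / k.factorial) * algebraMap ℚ R (1 / (n - k).factorial) =
      algebraMap ℚ R (1 / n.factorial) * (n.choose k : R) := by
    rw [← map_natCast (algebraMap ℚ R) (n.choose k), ← map_mul, ← map_mul, Nat.cast_choose ℚ hk']
    congr 1
    have h1 : (n.factorial : ℚ) ≠ 0 := by exact_mod_cast n.factorial_ne_zero
    have h2 : (k.factorial : ℚ) ≠ 0 := by exact_mod_cast k.factorial_ne_zero
    have h3 : ((n - k).factorial : ℚ) ≠ 0 := by exact_mod_cast (n - k).factorial_ne_zero
    field_simp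
  linear_combination (u k * v (n - k)) * h

theorem egf_sub (u v : ℕ → R) : egf (fun n => u n - v n) = egf u - egf v := by
  ext n; simp [egf, mul_sub]

theorem egf_add (u v : ℕ → R) : egf (fun n => u n + v n) = egf u + egf v := by
  ext n; simp [egf, mul_add]

theorem egf_const_mul (c : R) (u : ℕ → R) :
    egf (fun n => c * u n) = PowerSeries.C c * egf u := by
  ext n; simp [egf]; ring

/-- The series `exp (a x)`. -/
noncomputable def expSeries (a : R) : PowerSeries R := egf fun n => a ^ n

theorem egf_pow (a : R) : egf (fun n => a ^ n) = expSeries a := rfl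

theorem expSeries_mul (a b : R) : expSeries a * expSeries b = expSeries (a + b) := by
  rw [expSeries, expSeries, egf_mul, expSeries]
  congr 1
  funext n
  rw [add_pow]
  exact Finset.sum_congr rfl fun k _ => by ring

theorem expSeries_zero : expSeries (0 : R) = 1 := by
  ext n
  rcases eq_or_ne n 0 with rfl | hn
  · simp [expSeries, egf]
  · simp [expSeries, egf, hn, PowerSeries.coeff_one]

/-- The defining property of the exponential generating function of the polynomials `A⁺`. -/
def HasEulerianEGF (t r : R) (a : ℕ → R) : Prop :=
  egf a * (1 - PowerSeries.C t * expSeries ((1 - t) * r)) =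
    expSeries (1 - t) - PowerSeries.C t * expSeries ((1 - t) * r)

theorem HasEulerianEGF.unique [IsDomain R] {t r : R} (ht : t ≠ 1) {a b : ℕ → R}
    (ha : HasEulerianEGF t r a) (hb : HasEulerianEGF t r b) : a = b := by
  refine egf_injective (mul_right_cancel₀ ?_ (ha.trans hb.symm))
  intro h
  have h0 := congrArg (PowerSeries.coeff 0) h
  simp [expSeries, egf] at h0
  exact ht (sub_eq_zero.1 h0).symm

/-- In generating functions `hB` reads B (1 - t e^{(1-t)(s+1)x}) = (1-t) e^{(1-t)x}, and `hE` reads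
(1-t) E = B (1 - t e^{(1-t)sx}). Eliminate B and cancel 1-t. -/
theorem hasEulerianEGF_of_descents [IsDomain R] {t : R} (ht : t ≠ 1) (s : R) {B E : ℕ → R}
    (hB : ∀ n, B n - t * ∑ k ∈ Finset.range (n + 1), (n.choose k : R) *
      (((1 - t) * (s + 1)) ^ k * B (n - k)) = (1 - t) * (1 - t) ^ n)
    (hE : ∀ n, (1 - t) * E n = B n - t * ∑ k ∈ Finset.range (n + 1), (n.choose k : R) *
      (((1 - t) * s) ^ k * B (n - k))) :
    HasEulerianEGF t (s + 1) E := by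
  have h1 := congrArg egf (funext hB)
  have h2 := congrArg egf (funext hE)
  simp only [egf_sub, egf_const_mul, ← egf_mul] at h1 h2
  simp only [egf_pow] at h1 h2
  have h3 := expSeries_mul (1 - t) ((1 - t) * s)
  rw [show 1 - t + (1 - t) * s = (1 - t) * (s + 1) by ring] at h3
  refine mul_left_cancel₀ (C_one_sub_ne_zero ht) ?_
  linear_combination (1 - PowerSeries.C t * expSeries ((1 - t) * (s + 1))) * h2 +
    (1 - PowerSeries.C t * expSeries ((1 - t) * s)) * h1 -
    PowerSeries.C (1 - t) * PowerSeries.C t * h3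

/-- In generating functions `hD` reads D (e^{t(s+1)x} - t e^{(s+1)x}) = e^{tsx} - t e^{sx}, and `hA`
reads A = e^x D. Multiply the former by e^x and divide by e^{t(s+1)x}, using ts + 1 = t(s+1) +
(1-t). -/
theorem hasEulerianEGF_of_gamma {t : R} (s : R) {D A : ℕ → R}
    (hD : ∀ n, ∑ k ∈ Finset.range (n + 1), (n.choose k : R) * ((t * (s + 1)) ^ k * D (n - k)) -
      t * ∑ k ∈ Finset.range (n + 1), (n.choose k : R) * ((s + 1) ^ k * D (n - k)) =
      (t * s) ^ n - t * s ^ n)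
    (hA : ∀ n, A n = ∑ k ∈ Finset.range (n + 1), (n.choose k : R) * (D k * 1 ^ (n - k))) :
    HasEulerianEGF t (s + 1) A := by
  have h1 := congrArg egf (funext hD)
  have h2 := congrArg egf (funext hA)
  simp only [egf_sub, egf_const_mul, ← egf_mul] at h1 h2
  simp only [egf_pow] at h1 h2
  have e1 := expSeries_mul (t * (s + 1)) ((1 - t) * (s + 1))
  rw [show t * (s + 1) + (1 - t) * (s + 1) = s + 1 by ring] at e1
  have e2 := expSeries_mul (t * (s + 1)) (1 - t)
  have e3 := expSeries_mul (t * s) 1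
  rw [show t * s + 1 = t * (s + 1) + (1 - t) by ring] at e3
  have e4 := expSeries_mul s 1
  have e5 := expSeries_mul (t * (s + 1)) (-(t * (s + 1)))
  rw [add_neg_cancel, expSeries_zero] at e5
  have key : expSeries (t * (s + 1)) * (egf A * (1 - PowerSeries.C t *
      expSeries ((1 - t) * (s + 1)))) = expSeries (t * (s + 1)) *
      (expSeries (1 - t) - PowerSeries.C t * expSeries ((1 - t) * (s + 1))) := by
    rw [h2]
    linear_combination expSeries 1 * h1 - egf D * expSeries 1 * PowerSeries.C t * e1 + e3 -
      PowerSeries.C t * e4 - e2 + PowerSeries.C t * e1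
  unfold HasEulerianEGF
  linear_combination expSeries (-(t * (s + 1))) * key + (expSeries (1 - t) -
      PowerSeries.C t * expSeries ((1 - t) * (s + 1)) - (egf A * (1 - PowerSeries.C t *
      expSeries ((1 - t) * (s + 1))))) * e5

end ExponentialGeneratingFunctions

/-! ### The reference series Σ ((rk+1)^n - (rk)^n) t^k. -/

section Hub

/-- The power series `∑ⱼ (r j + c)ⁿ tʲ`. -/
noncomputable def linearPowSeries (r c n : ℕ) : PowerSeries ℚ :=
  PowerSeries.mk fun j => ((r : ℚ) * j + c) ^ n

theorem linearPowSeries_shift (r c n : ℕ) :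
    ∑ k ∈ Finset.range (n + 1), (n.choose k : PowerSeries ℚ) *
      ((r : PowerSeries ℚ) ^ k * linearPowSeries r c (n - k)) = linearPowSeries r (c + r) n := by
  ext j
  simp only [map_sum, linearPowSeries, PowerSeries.coeff_mk]
  push_cast
  rw [show (r : ℚ) * j + (c + r) = r + (r * j + c) by ring, add_pow]
  refine Finset.sum_congr rfl fun k _ => ?_
  rw [← Nat.cast_pow, ← mul_assoc, ← Nat.cast_mul, ← map_natCast (PowerSeries.C (R := ℚ)),
    PowerSeries.coeff_C_mul, PowerSeries.coeff_mk]
  push_cast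
  ring

theorem linearPowSeries_sub_X_mul (r c n : ℕ) :
    linearPowSeries r c n - PowerSeries.X * linearPowSeries r (c + r) n =
      PowerSeries.C ((c : ℚ) ^ n) := by
  ext j
  rcases j with _ | j
  · simp [linearPowSeries]
  · simp only [linearPowSeries, map_sub, PowerSeries.coeff_mk, PowerSeries.coeff_succ_X_mul,
      PowerSeries.coeff_C, Nat.succ_ne_zero, if_false]
    push_cast
    ring

/-- The power series `(1 - t)ⁿ ∑ₖ ((r k + 1)ⁿ - (r k)ⁿ) tᵏ`, equal to `1` for `n = 0`. -/
noncomputable def eulerianSeries (r n : ℕ) : PowerSeries ℚ :=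
  0 ^ n + (1 - PowerSeries.X) ^ n * (linearPowSeries r 1 n - linearPowSeries r 0 n)

theorem hasEulerianEGF_eulerianSeries (r : ℕ) :
    HasEulerianEGF (PowerSeries.X : PowerSeries ℚ) (r : PowerSeries ℚ) (eulerianSeries r) := by
  -- The geometric series Σ_j t^j e^{(1-t)(rj+c)x} = e^{(1-t)cx} / (1 - t e^{(1-t)rx}); the claim is
  -- the difference of the cases c = 1 and c = 0, plus 1 from the term 0^n.
  have key : ∀ c : ℕ, egf (fun n => (1 - PowerSeries.X) ^ n * linearPowSeries r c n) *
      (1 - PowerSeries.C PowerSeries.X * expSeries ((1 - PowerSeries.X) * (r : PowerSeries ℚ))) =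
      expSeries ((1 - PowerSeries.X) * (c : PowerSeries ℚ)) := by
    intro c
    rw [mul_sub, mul_one, mul_comm, mul_assoc, expSeries, egf_mul, ← egf_const_mul, ← egf_sub,
      expSeries]
    congr 1
    funext n
    have hc : (c : PowerSeries ℚ) ^ n = PowerSeries.C ((c : ℚ) ^ n) := by simp
    rw [mul_pow, hc, ← linearPowSeries_sub_X_mul r, ← linearPowSeries_shift, mul_sub]
    have h : ∑ k ∈ Finset.range (n + 1), (n.choose k : PowerSeries ℚ) *
        (((1 - PowerSeries.X) * (r : PowerSeries ℚ)) ^ k *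
          ((1 - PowerSeries.X) ^ (n - k) * linearPowSeries r c (n - k))) =
        (1 - PowerSeries.X) ^ n * ∑ k ∈ Finset.range (n + 1), (n.choose k : PowerSeries ℚ) *
          ((r : PowerSeries ℚ) ^ k * linearPowSeries r c (n - k)) := by
      rw [Finset.mul_sum]
      refine Finset.sum_congr rfl fun k hk => ?_
      have hk' : (1 - PowerSeries.X : PowerSeries ℚ) ^ n =
          (1 - PowerSeries.X) ^ k * (1 - PowerSeries.X) ^ (n - k) := by
        rw [← pow_add, Nat.add_sub_cancel' (Nat.lt_succ_iff.1 (Finset.mem_range.1 hk))]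
      rw [hk', mul_pow]
      ring
    rw [h]
    ring
  have h1 := key 1
  have h0 := key 0
  rw [Nat.cast_one, mul_one] at h1
  rw [Nat.cast_zero, mul_zero, expSeries_zero] at h0
  unfold HasEulerianEGF
  have h2 : egf (eulerianSeries r) = 1 +
      (egf (fun n => (1 - PowerSeries.X) ^ n * linearPowSeries r 1 n) -
      egf (fun n => (1 - PowerSeries.X) ^ n * linearPowSeries r 0 n)) := by
    rw [← egf_sub, ← expSeries_zero, expSeries, ← egf_add]
    congr 1
    funext n
    rw [eulerianSeries]
    ring
  rw [h2]
  linear_combination h1 - h0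

end Hub

/-! ### Colored permutations as words over ordered letters. -/

/-- Letters: colored natural numbers, ordered first by color and then by value. -/
abbrev Letter (r : ℕ) : Type := Fin r ×ₗ ℕ

namespace Letter

variable {r : ℕ}

/-- The color of a letter. -/
def color (x : Letter r) : ℕ := (ofLex x).1

/-- The value of a letter. -/
def value (x : Letter r) : ℕ := (ofLex x).2

theorem lt_iff (x y : Letter r) :
    x < y ↔ x.color < y.color ∨ (x.color = y.color ∧ x.value < y.value) := by
  rw [Prod.Lex.lt_iff]
  simp only [color, value, Fin.ext_iff]
  rfl

theorem color_le_of_le {x y : Letter r} (h : x ≤ y) : x.color ≤ y.color := by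
  rcases h.lt_or_eq with h | rfl
  · rw [lt_iff] at h; omega
  · rfl

end Letter

section Words

variable {r : ℕ}

/-- The word `σ(1)^ε(1), …, σ(n)^ε(n)` of a colored permutation, written in the values of `A`. -/
def ColoredPerm.word (A : Finset ℕ) {n : ℕ} (h : A.card = n) (w : ColoredPerm n r) :
    List (Letter r) :=
  List.ofFn fun k => toLex (w.2 k, A.orderEmbOfFin h (w.1 k))

theorem ColoredPerm.word_injective (A : Finset ℕ) {n : ℕ} (h : A.card = n) :
    Function.Injective (ColoredPerm.word (r := r) A h) := by
  intro w w' hw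
  have h1 := List.ofFn_injective hw
  have h2 : ∀ k, w.2 k = w'.2 k ∧ w.1 k = w'.1 k := fun k => by
    have := congrFun h1 k
    simpa using this
  exact Prod.ext (Equiv.ext fun k => (h2 k).2) (funext fun k => (h2 k).1)

/-- The words with pairwise distinct values forming the set `A`. -/
def words (r : ℕ) (A : Finset ℕ) : Finset (List (Letter r)) :=
  Finset.univ.image (ColoredPerm.word A rfl)

theorem sum_words {M : Type*} [AddCommMonoid M] (A : Finset ℕ) {n : ℕ} (h : A.card = n)
    (f : List (Letter r) → M) :
    ∑ l ∈ words r A, f l = ∑ w : ColoredPerm n r, f (w.word A h) := by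
  subst h
  exact Finset.sum_image fun _ _ _ _ => fun h => ColoredPerm.word_injective A rfl h

theorem mem_words {A : Finset ℕ} {l : List (Letter r)} :
    l ∈ words r A ↔ (l.map Letter.value).Nodup ∧ (l.map Letter.value).toFinset = A := by
  constructor
  · intro h
    obtain ⟨w, -, rfl⟩ := Finset.mem_image.1 h
    have h1 : (w.word A rfl).map Letter.value = List.ofFn fun k => A.orderEmbOfFin rfl (w.1 k) := by
      rw [ColoredPerm.word, List.map_ofFn]; rfl
    rw [h1]
    refine ⟨List.nodup_ofFn.2 fun a b hab => by simpa using hab, ?_⟩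
    ext a
    simp only [List.mem_toFinset, List.mem_ofFn]
    constructor
    · rintro ⟨k, rfl⟩
      exact Finset.orderEmbOfFin_mem _ _ _
    · intro ha
      have : a ∈ Set.range (A.orderEmbOfFin rfl) := by
        rw [Finset.range_orderEmbOfFin]; exact ha
      obtain ⟨k, hk⟩ := this
      exact ⟨w.1.symm k, by simpa using hk⟩
  · rintro ⟨hnd, rfl⟩
    set A := (l.map Letter.value).toFinset with hA
    have hlen : A.card = l.length := by
      rw [hA, List.toFinset_card_of_nodup hnd, List.length_map]
    have hmem : ∀ k : Fin A.card, ∃ j, A.orderEmbOfFin rfl j = (l.get (k.cast hlen)).value := by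
      intro k
      have : (l.get (k.cast hlen)).value ∈ Set.range (A.orderEmbOfFin rfl) := by
        rw [Finset.range_orderEmbOfFin]
        exact List.mem_toFinset.2 (List.mem_map_of_mem (List.get_mem _ _))
      exact this
    choose s hs using hmem
    have hinj : Function.Injective s := by
      intro a b hab
      have h1 : (l.get (a.cast hlen)).value = (l.get (b.cast hlen)).value := by
        rw [← hs, ← hs, hab]
      have h2 := List.nodup_iff_injective_get.1 hnd
      have h3 := @h2 ⟨a, by simp [← hlen]⟩ ⟨b, by simp [← hlen]⟩ (by simpa using h1)
      exact Fin.ext (by simpa using h3)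
    refine Finset.mem_image.2 ⟨(Equiv.ofBijective s (Finite.injective_iff_bijective.1 hinj),
      fun k => (ofLex (l.get (k.cast hlen))).1), Finset.mem_univ _, ?_⟩
    rw [ColoredPerm.word]
    refine List.ext_get (by simp [hlen]) fun i h1 h2 => ?_
    simp only [List.get_eq_getElem, List.getElem_ofFn, Equiv.ofBijective_apply, hs]
    rfl

theorem length_of_mem_words {A : Finset ℕ} {l : List (Letter r)} (h : l ∈ words r A) :
    l.length = A.card := by
  obtain ⟨h1, h2⟩ := mem_words.1 h
  rw [← h2, List.toFinset_card_of_nodup h1, List.length_map]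

/-- Cutting a word amounts to choosing the set of values before the cut and arranging the two
complementary sets independently. This is why words are allowed arbitrary finite value sets. -/
theorem sum_words_splits {R : Type*} [CommRing R] (A : Finset ℕ) (q f : List (Letter r) → R) :
    ∑ w ∈ words r A, ∑ i ∈ Finset.range (w.length + 1), q (w.take i) * f (w.drop i) =
      ∑ S ∈ A.powerset, (∑ v ∈ words r S, q v) * ∑ u ∈ words r (A \ S), f u := by
  simp only [Finset.sum_mul_sum, ← Finset.sum_product']
  rw [Finset.sum_sigma', Finset.sum_sigma']
  refine Finset.sum_bij' (fun x _ => ⟨((x.1.take x.2).map Letter.value).toFinset,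
    (x.1.take x.2, x.1.drop x.2)⟩) (fun y _ => ⟨y.2.1 ++ y.2.2, y.2.1.length⟩) ?_ ?_ ?_ ?_ ?_
  · rintro ⟨w, i⟩ h
    simp only [Finset.mem_sigma, Finset.mem_range, Finset.mem_product, Finset.mem_powerset] at h ⊢
    obtain ⟨hnd, hA⟩ := mem_words.1 h.1
    rw [← List.take_append_drop i w, List.map_append] at hnd hA
    rw [List.toFinset_append] at hA
    rw [List.nodup_append] at hnd
    refine ⟨?_, mem_words.2 ⟨hnd.1, rfl⟩, mem_words.2 ⟨hnd.2.1, ?_⟩⟩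
    · rw [← hA]; exact Finset.subset_union_left
    · rw [← hA, Finset.union_sdiff_left, Finset.sdiff_eq_self_of_disjoint]
      rw [Finset.disjoint_left]
      intro a ha hb
      exact hnd.2.2 a (List.mem_toFinset.1 hb) a (List.mem_toFinset.1 ha) rfl
  · rintro ⟨S, v, u⟩ h
    simp only [Finset.mem_sigma, Finset.mem_range, Finset.mem_product, Finset.mem_powerset] at h ⊢
    obtain ⟨hS, hv, hu⟩ := h
    rw [mem_words] at hv hu
    refine ⟨mem_words.2 ⟨?_, ?_⟩, ?_⟩
    · rw [List.map_append, List.nodup_append]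
      refine ⟨hv.1, hu.1, fun a ha b hb hab => ?_⟩
      rw [← List.mem_toFinset, hv.2] at ha
      rw [← List.mem_toFinset, hu.2] at hb
      exact (Finset.mem_sdiff.1 hb).2 (hab ▸ ha)
    · rw [List.map_append, List.toFinset_append, hv.2, hu.2, Finset.union_sdiff_of_subset hS]
    · simp
  · rintro ⟨w, i⟩ h
    simp only [Finset.mem_sigma, Finset.mem_range] at h
    simp [Nat.lt_succ_iff.1 h.2]
  · rintro ⟨S, v, u⟩ h
    simp only [Finset.mem_sigma, Finset.mem_product] at h
    have := (mem_words.1 h.2.1).2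
    simp [this]
  · rintro ⟨w, i⟩ h
    rfl

/-- Monotone words with values in `S` and colors in `C` correspond to maps from `S` to `C`. -/
theorem card_sorted_words (rel : Letter r → Letter r → Prop) [DecidableRel rel]
    [IsTrans _ rel] [Std.Antisymm rel] [Std.Total rel] (C : Finset (Fin r)) (S : Finset ℕ) :
    ((words r S).filter fun v => v.Pairwise rel ∧ ∀ x ∈ v, (ofLex x).1 ∈ C).card =
      C.card ^ S.card := by
  classical
  have hc : Fintype.card (S → C) = C.card ^ S.card := by simp
  rw [← hc, ← Finset.card_univ]
  symm
  have key : ∀ c : S → C, ∀ x : Letter r,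
      x ∈ (Finset.univ.image fun a : S => (toLex ((c a : Fin r), (a : ℕ)) : Letter r)).sort rel ↔
      ∃ a : S, toLex ((c a : Fin r), (a : ℕ)) = x := by
    intro c x
    simp
  refine Finset.card_bij (fun c _ => (Finset.univ.image fun a : S =>
    (toLex ((c a : Fin r), (a : ℕ)) : Letter r)).sort rel) ?_ ?_ ?_
  · intro c _
    refine Finset.mem_filter.2 ⟨mem_words.2 ⟨?_, ?_⟩, Finset.pairwise_sort _ _, ?_⟩
    · refine List.Nodup.map_on ?_ (Finset.sort_nodup _ _)
      intro x hx y hy hxy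
      obtain ⟨a, rfl⟩ := (key c x).1 hx
      obtain ⟨b, rfl⟩ := (key c y).1 hy
      have : a = b := Subtype.ext hxy
      rw [this]
    · ext a
      simp only [List.mem_toFinset, List.mem_map]
      constructor
      · rintro ⟨x, hx, rfl⟩
        obtain ⟨a, rfl⟩ := (key c x).1 hx
        exact a.2
      · intro ha
        exact ⟨_, (key c _).2 ⟨⟨a, ha⟩, rfl⟩, rfl⟩
    · intro x hx
      obtain ⟨a, rfl⟩ := (key c x).1 hx
      exact (c a).2
  · intro c _ d _ h
    funext a
    have h1 := (key c _).2 ⟨a, rfl⟩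
    rw [show _ = _ from h] at h1
    obtain ⟨b, hb⟩ := (key d _).1 h1
    have h2 := congrArg ofLex hb
    simp only [ofLex_toLex, Prod.mk.injEq] at h2
    have h3 : b = a := Subtype.ext h2.2
    subst h3
    exact Subtype.ext h2.1.symm
  · intro v hv
    obtain ⟨hv, hp, hC⟩ := Finset.mem_filter.1 hv
    obtain ⟨hnd, hS⟩ := mem_words.1 hv
    have hex : ∀ a : S, ∃ x ∈ v, x.value = a := by
      intro a
      have : (a : ℕ) ∈ (v.map Letter.value).toFinset := hS.symm ▸ a.2
      simpa using this
    choose g hg1 hg2 using hex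
    refine ⟨fun a => ⟨(ofLex (g a)).1, hC _ (hg1 a)⟩, Finset.mem_univ _, ?_⟩
    -- Two sorted lists with the same letters coincide, so a monotone word is recovered from its
    -- coloring.
    refine List.Perm.eq_of_pairwise' (r := rel) ?_ hp ?_
    · exact Finset.pairwise_sort _ _
    · rw [List.perm_ext_iff_of_nodup (Finset.sort_nodup _ _) (List.Nodup.of_map _ hnd)]
      intro x
      rw [Finset.mem_sort, Finset.mem_image]
      have hgx : ∀ a : S, (toLex ((ofLex (g a)).1, (a : ℕ)) : Letter r) = g a := by
        intro a
        conv_lhs => rw [← hg2 a]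
        rfl
      constructor
      · rintro ⟨a, -, rfl⟩
        simp only [hgx]
        exact hg1 a
      · intro hx
        have ha : x.value ∈ S := by
          rw [← hS]; simp only [List.mem_toFinset]; exact List.mem_map_of_mem hx
        refine ⟨⟨x.value, ha⟩, Finset.mem_univ _, ?_⟩
        simp only [hgx]
        exact List.inj_on_of_nodup_map hnd (hg1 _) hx (hg2 _)

end Words

/-! ### Ascent patterns of words. -/

section Patterns

variable {r : ℕ}

/-- Whether the first position of a word is a descent; a letter which is not followed by another
one is a descent if its color is nonzero. -/
def headDescent : List (Letter r) → Bool
  | [] => false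
  | [x] => decide (0 < x.color)
  | x :: y :: _ => decide (y < x)

/-- The list recording which positions of a word are ascents. -/
def ascPattern : List (Letter r) → List Bool
  | [] => []
  | x :: w => (!headDescent (x :: w)) :: ascPattern w

theorem length_ascPattern (l : List (Letter r)) : (ascPattern l).length = l.length := by
  induction l with
  | nil => rfl
  | cons x w ih => simp [ascPattern, ih]

theorem getElem_ascPattern (l : List (Letter r)) (i : ℕ) (h : i < (ascPattern l).length) :
    (ascPattern l)[i] = !headDescent (l.drop i) := by
  induction l generalizing i with
  | nil => simp [ascPattern] at h
  | cons x w ih =>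
    rcases i with _ | i
    · simp [ascPattern]
    · simp only [ascPattern, List.getElem_cons_succ, List.drop_succ_cons]
      exact ih _ _

theorem ColoredPerm.mem_Asc {n : ℕ} (w : ColoredPerm n r) (k : Fin n) :
    k ∈ w.Asc ↔ ¬ (w.nextColor k < (w.2 k : ℕ) ∨
      ((w.2 k : ℕ) = w.nextColor k ∧ w.nextValue k < (w.1 k : ℕ))) := by
  rw [ColoredPerm.Asc, Finset.mem_sdiff, ColoredPerm.Des, Finset.mem_filter]
  simp only [Finset.mem_univ, true_and]

theorem ascPattern_word (A : Finset ℕ) {n : ℕ} (h : A.card = n) (w : ColoredPerm n r) :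
    ascPattern (w.word A h) = List.ofFn fun k => decide (k ∈ w.Asc) := by
  have hl : (w.word A h).length = n := by simp [ColoredPerm.word]
  refine List.ext_get (by simp [length_ascPattern, hl]) fun i h1 h2 => ?_
  have hi : i < n := by simpa using h2
  simp only [List.get_eq_getElem, getElem_ascPattern, List.getElem_ofFn]
  rw [List.drop_eq_getElem_cons (by omega)]
  have hdec : ∀ b : Bool, ∀ p : Prop, ∀ _ : Decidable p, (b = true ↔ ¬ p) → (!b) = decide p := by
    intro b p _ hb
    by_cases hp : p <;> simp_all
  refine hdec _ _ _ ?_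
  have hget : ∀ (j : ℕ) (hj : j < (w.word A h).length),
      (w.word A h)[j] = toLex (w.2 ⟨j, hl ▸ hj⟩, A.orderEmbOfFin h (w.1 ⟨j, hl ▸ hj⟩)) := by
    intro j hj
    simp [ColoredPerm.word]
  rw [ColoredPerm.mem_Asc, not_not, ColoredPerm.nextColor, ColoredPerm.nextValue]
  by_cases hn : i + 1 < n
  · rw [List.drop_eq_getElem_cons (by omega), headDescent, decide_eq_true_iff, hget, hget,
      Letter.lt_iff]
    simp only [dif_pos hn, Letter.color, Letter.value, ofLex_toLex, OrderEmbedding.lt_iff_lt,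
      Fin.lt_def, eq_comm]
  -- At the last position the conventional next value n exceeds every value, so only a positive
  -- color makes a descent.
  · rw [List.drop_eq_nil_of_le (by omega), headDescent, decide_eq_true_iff, hget]
    simp only [dif_neg hn, Letter.color, ofLex_toLex]
    have := (w.1 ⟨i, hi⟩).2
    constructor
    · exact Or.inl
    · rintro (h | h)
      · exact h
      · omega

theorem count_ofFn {n : ℕ} (b : Fin n → Bool) (c : Bool) :
    (List.ofFn b).count c = (Finset.univ.filter fun k => b k = c).card := by
  induction n with
  | zero => simp
  | succ n ih =>
    rw [List.ofFn_succ, List.count_cons, ih, Finset.card_filter, Finset.card_filter,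
      Fin.sum_univ_succ, add_comm]
    simp

theorem count_false_ascPattern (A : Finset ℕ) {n : ℕ} (h : A.card = n) (w : ColoredPerm n r) :
    (ascPattern (w.word A h)).count false = w.des := by
  rw [ascPattern_word, count_ofFn, ColoredPerm.des]
  congr 1
  ext k
  simp [ColoredPerm.Asc]

end Patterns

/-! ### Word-by-word cancellation in sums over monotone prefixes. -/

section ChainSums

variable {r : ℕ} {R : Type*} [CommRing R]

/-- The sum of `aⁱ f (drop i l)` over all `i` such that the first `i` letters of `l` form a chain
with colors in `C`. -/
def prefixSum (rel : Letter r → Letter r → Prop) [DecidableRel rel] (C : Finset (Fin r)) (a : R)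
    (f : List (Letter r) → R) (l : List (Letter r)) : R :=
  ∑ i ∈ Finset.range (l.length + 1),
    (if (l.take i).Pairwise rel ∧ ∀ x ∈ l.take i, (ofLex x).1 ∈ C then a ^ (l.take i).length
      else 0) * f (l.drop i)

/-- The generating function of `F` gets multiplied by e^{a|C|x}: a value set of size k carries |C|^k
monotone prefixes, each of weight a^k. -/
theorem sum_words_prefixSum (rel : Letter r → Letter r → Prop) [DecidableRel rel]
    [IsTrans _ rel] [Std.Antisymm rel] [Std.Total rel] (C : Finset (Fin r)) (a : R)
    (f : List (Letter r) → R) (F : ℕ → R) (hF : ∀ A, ∑ l ∈ words r A, f l = F A.card)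
    (A : Finset ℕ) :
    ∑ l ∈ words r A, prefixSum rel C a f l = ∑ k ∈ Finset.range (A.card + 1),
      (A.card.choose k : R) * ((a * C.card) ^ k * F (A.card - k)) := by
  simp only [prefixSum]
  rw [sum_words_splits A (fun v => if v.Pairwise rel ∧ ∀ x ∈ v, (ofLex x).1 ∈ C then a ^ v.length
    else 0) f, Finset.sum_powerset]
  refine Finset.sum_congr rfl fun k hk => ?_
  rw [← Finset.card_powersetCard, ← nsmul_eq_mul]
  refine Finset.sum_eq_card_nsmul fun S hS => ?_
  obtain ⟨hS', rfl⟩ := Finset.mem_powersetCard.1 hS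
  rw [hF, Finset.card_sdiff_of_subset hS']
  congr 1
  rw [← Finset.sum_filter, Finset.sum_congr rfl (g := fun _ => a ^ S.card), Finset.sum_const,
    card_sorted_words, nsmul_eq_mul, mul_pow, mul_comm]
  · push_cast; rfl
  · intro v hv
    rw [length_of_mem_words (Finset.mem_filter.1 hv).1]

theorem prefixSum_nil (rel : Letter r → Letter r → Prop) [DecidableRel rel] (C : Finset (Fin r))
    (a : R) (f : List (Letter r) → R) : prefixSum rel C a f [] = f [] := by
  simp [prefixSum]

/-- A nonempty prefix contains x. If `rel x y` holds, x can be added to any chain prefix of the tail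
without breaking it; otherwise only the prefix [x] survives. -/
theorem prefixSum_cons_cons (rel : Letter r → Letter r → Prop) [DecidableRel rel] [IsTrans _ rel]
    (a : R) (f : List (Letter r) → R) (x y : Letter r) (w : List (Letter r)) :
    prefixSum rel Finset.univ a f (x :: y :: w) = f (x :: y :: w) +
      a * if rel x y then prefixSum rel Finset.univ a f (y :: w) else f (y :: w) := by
  simp only [prefixSum, Finset.mem_univ, implies_true, and_true]
  rw [List.length_cons, Finset.sum_range_succ' _ ((y :: w).length + 1), add_comm]
  congr 1
  · simp
  · split_ifs with h
    · rw [Finset.mul_sum]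
      refine Finset.sum_congr rfl fun i _ => ?_
      have : ((x :: y :: w).take (i + 1)).Pairwise rel ↔ ((y :: w).take i).Pairwise rel := by
        rw [← List.isChain_iff_pairwise, ← List.isChain_iff_pairwise]
        rcases i with _ | i
        · simp
        · simp [h]
      simp only [this]
      split_ifs
      · simp [pow_succ']; ring
      · simp
    · rw [Finset.sum_range_succ']
      rw [Finset.sum_eq_zero]
      · simp
      · intro i _
        simp [h]

theorem prefixSum_singleton (rel : Letter r → Letter r → Prop) [DecidableRel rel]
    (a : R) (f : List (Letter r) → R) (x : Letter r) :
    prefixSum rel Finset.univ a f [x] = f [x] + a * f [] := by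
  simp [prefixSum, Finset.sum_range_succ]

/-- The weight `t ^ des` of a word. -/
def desWeight (t : R) (l : List (Letter r)) : R := t ^ (ascPattern l).count false

/-- Write d for the weight and P for the prefix sum of the tail y w. An initial ascent gives d - t(d
+ (1-t)P) = (1-t)(d - tP), so induction applies; an initial descent gives td - t(td + (1-t)d) = 0.
-/
theorem desWeight_sub_prefixSum (t : R) (l : List (Letter r)) :
    desWeight t l - t * prefixSum (· ≤ ·) Finset.univ (1 - t) (desWeight t) l =
      if l.Pairwise (· ≤ ·) ∧ ∀ x ∈ l, x.color = 0 then (1 - t) * (1 - t) ^ l.length else 0 := by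
  induction l with
  | nil => simp [prefixSum_nil, desWeight, ascPattern]
  | cons x w ih =>
    rcases w with _ | ⟨y, w⟩
    · rw [prefixSum_singleton]
      rcases Nat.eq_zero_or_pos x.color with h | h
      · simp [desWeight, ascPattern, headDescent, h]
        ring
      · simp [desWeight, ascPattern, headDescent, h, h.ne']
    · rw [prefixSum_cons_cons]
      have hx : desWeight t (x :: y :: w) =
          if x ≤ y then desWeight t (y :: w) else t * desWeight t (y :: w) := by
        rw [desWeight, desWeight, ascPattern, headDescent]
        split_ifs with h
        · simp [h]
        · simp [not_le.1 h, pow_succ']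
      rw [hx]
      by_cases h : x ≤ y
      · simp only [if_pos h]
        have hiff : ((x :: y :: w).Pairwise (· ≤ ·) ∧ ∀ z ∈ x :: y :: w, z.color = 0) ↔
            ((y :: w).Pairwise (· ≤ ·) ∧ ∀ z ∈ y :: w, z.color = 0) := by
          rw [← List.isChain_iff_pairwise, ← List.isChain_iff_pairwise, List.isChain_cons_cons,
            List.forall_mem_cons (a := x)]
          constructor
          · rintro ⟨⟨-, h1⟩, -, h2⟩
            exact ⟨h1, h2⟩
          · rintro ⟨h1, h2⟩
            refine ⟨⟨h, h1⟩, ?_, h2⟩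
            have := Letter.color_le_of_le h
            have := h2 y (by simp)
            omega
        rw [if_congr hiff rfl rfl, List.length_cons, pow_succ']
        split_ifs with h'
        · rw [if_pos h'] at ih
          linear_combination (1 - t) * ih
        · rw [if_neg h'] at ih
          linear_combination (1 - t) * ih
      · simp only [if_neg h]
        rw [if_neg]
        · ring
        · rw [← List.isChain_iff_pairwise, List.isChain_cons_cons]
          tauto

/-- The colors different from zero. -/
def nonzeroColors (r : ℕ) : Finset (Fin r) := Finset.univ.filter fun c => (c : ℕ) ≠ 0

theorem card_nonzeroColors (s : ℕ) : (nonzeroColors (s + 1)).card = s := by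
  have : nonzeroColors (s + 1) = Finset.univ.erase 0 := by
    ext c
    simp only [nonzeroColors, Finset.mem_filter, Finset.mem_univ, true_and, Finset.mem_erase,
      and_true, ne_eq, Fin.ext_iff, Fin.val_zero]
  rw [this, Finset.card_erase_of_mem (Finset.mem_univ _)]
  simp

/-- If the first color is zero, only the empty prefix is admitted. Otherwise colors weakly increase
along a monotone prefix and stay nonzero, so the restriction is vacuous; the word is not entirely of
color zero, and the previous identity gives 0. -/
theorem desWeight_sub_prefixSum_nonzeroColors (t : R) (l : List (Letter r)) :
    desWeight t l - t * prefixSum (· ≤ ·) (nonzeroColors r) (1 - t) (desWeight t) l =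
      if ∀ x ∈ l.head?, x.color = 0 then (1 - t) * desWeight t l else 0 := by
  rcases l with _ | ⟨x, w⟩
  · simp [prefixSum_nil]; ring
  · by_cases h : x.color = 0
    · have : prefixSum (· ≤ ·) (nonzeroColors r) (1 - t) (desWeight t) (x :: w) =
          desWeight t (x :: w) := by
        rw [prefixSum, Finset.sum_range_succ', Finset.sum_eq_zero]
        · simp
        · intro i _
          rw [if_neg, zero_mul]
          rintro ⟨-, h1⟩
          have := h1 x (by simp)
          exact (Finset.mem_filter.1 this).2 h
      rw [this]
      simp [h]
      ring
    · have : prefixSum (· ≤ ·) (nonzeroColors r) (1 - t) (desWeight t) (x :: w) =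
          prefixSum (· ≤ ·) Finset.univ (1 - t) (desWeight t) (x :: w) := by
        refine Finset.sum_congr rfl fun i _ => ?_
        congr 1
        refine if_congr ?_ rfl rfl
        simp only [Finset.mem_univ, implies_true, and_true, and_iff_left_iff_imp]
        intro hp z hz
        refine Finset.mem_filter.2 ⟨Finset.mem_univ _, ?_⟩
        rcases i with _ | i
        · simp at hz
        · rw [List.take_succ_cons] at hp hz
          rcases List.mem_cons.1 hz with rfl | hz
          · exact h
          · have := Letter.color_le_of_le ((List.pairwise_cons.1 hp).1 z hz)
            change z.color ≠ 0
            omega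
      rw [this, desWeight_sub_prefixSum]
      simp [h]

/-- The weight of an ascent pattern: `tⁱ (1 + t)^(n - 2i)` if its `i` ascents are not at the first
position, include the last position and are pairwise nonconsecutive, and zero otherwise. -/
def patternWeight (t : R) : List Bool → R
  | [] => 1
  | [_] => 0
  | true :: _ => 0
  | false :: true :: l => t * patternWeight t l
  | false :: false :: l => (1 + t) * patternWeight t (false :: l)

/-- The weight of a word in the expansion of `d⁺`. -/
def gammaWeight (t : R) (l : List (Letter r)) : R := patternWeight t (ascPattern l)

theorem patternWeight_true (t : R) (l : List Bool) : patternWeight t (true :: l) = 0 := by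
  cases l <;> simp [patternWeight]

theorem ascPattern_cons_cons (x y : Letter r) (w : List (Letter r)) :
    ascPattern (x :: y :: w) = (!decide (y < x)) :: ascPattern (y :: w) := rfl

theorem decreasing_nonzero_cons_iff {x y : Letter r} (w : List (Letter r)) (h : y < x) :
    ((x :: y :: w).Pairwise (· ≥ ·) ∧ ∀ z ∈ x :: y :: w, z.color ≠ 0) ↔
      ((y :: w).Pairwise (· ≥ ·) ∧ ∀ z ∈ y :: w, z.color ≠ 0) := by
  rw [← List.isChain_iff_pairwise, ← List.isChain_iff_pairwise, List.isChain_cons_cons,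
    List.forall_mem_cons (a := x)]
  constructor
  · rintro ⟨⟨-, h1⟩, -, h2⟩
    exact ⟨h1, h2⟩
  · rintro ⟨h1, h2⟩
    refine ⟨⟨h.le, h1⟩, ?_, h2⟩
    have := Letter.color_le_of_le h.le
    have := h2 y (by simp)
    omega

/-- The cancellation wanted is P_t = t P_1 for the prefix sums P_a; the induction needs the sharper
fact that both sides equal (1+t) times the weight of the word. A further descent in front multiplies
the weight by 1+t, while a descent followed by an ascent restarts the recursion with a factor t. The
exceptional words are those without ascents: decreasing, with nonzero colors because the last
position must be a descent too. -/
theorem prefixSum_gammaWeight_of_lt (t : R) (x y : Letter r) (w : List (Letter r)) (h : y < x)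
    (hnd : (x :: y :: w).Nodup) :
    if (x :: y :: w).Pairwise (· ≥ ·) ∧ ∀ z ∈ x :: y :: w, z.color ≠ 0 then
      gammaWeight t (x :: y :: w) = 0 ∧ ∀ a, prefixSum (· ≥ ·) Finset.univ a (gammaWeight t)
        (x :: y :: w) = a ^ (x :: y :: w).length
    else t * prefixSum (· ≥ ·) Finset.univ 1 (gammaWeight t) (x :: y :: w) =
        (1 + t) * gammaWeight t (x :: y :: w) ∧
      prefixSum (· ≥ ·) Finset.univ t (gammaWeight t) (x :: y :: w) =
        (1 + t) * gammaWeight t (x :: y :: w) := by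
  have hP : ∀ a, prefixSum (· ≥ ·) Finset.univ a (gammaWeight t) (x :: y :: w) =
      gammaWeight t (x :: y :: w) + a * prefixSum (· ≥ ·) Finset.univ a (gammaWeight t) (y :: w) := by
    intro a
    rw [prefixSum_cons_cons, if_pos h.le]
  rw [if_congr (decreasing_nonzero_cons_iff w h) rfl rfl]
  simp only [hP]
  clear hP
  induction w generalizing x y with
  | nil =>
    simp only [prefixSum_singleton]
    have h2 : gammaWeight t [y] = 0 := by simp [gammaWeight, ascPattern, patternWeight]
    have h3 : gammaWeight t ([] : List (Letter r)) = 1 := rfl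
    rcases Nat.eq_zero_or_pos y.color with hc | hc
    · rw [if_neg (by simp [hc])]
      have h1 : gammaWeight t [x, y] = t := by
        simp [gammaWeight, ascPattern, headDescent, h, hc, patternWeight]
      rw [h1, h2, h3]
      constructor <;> ring
    · rw [if_pos (by simp [hc.ne'])]
      have h1 : gammaWeight t [x, y] = 0 := by
        simp [gammaWeight, ascPattern, headDescent, h, hc, patternWeight]
      rw [h1, h2, h3]
      refine ⟨rfl, fun a => ?_⟩
      simp only [List.length_cons, List.length_nil]
      ring
  | cons z w ih =>
    have hnd' := (List.nodup_cons.1 hnd).2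
    rcases lt_or_ge z y with hz | hz
    · have h1 : gammaWeight t (x :: y :: z :: w) = (1 + t) * gammaWeight t (y :: z :: w) := by
        rw [gammaWeight, gammaWeight, ascPattern_cons_cons, ascPattern_cons_cons]
        simp [h, hz, patternWeight]
      have hP : ∀ a, prefixSum (· ≥ ·) Finset.univ a (gammaWeight t) (y :: z :: w) =
          gammaWeight t (y :: z :: w) +
            a * prefixSum (· ≥ ·) Finset.univ a (gammaWeight t) (z :: w) := by
        intro a
        rw [prefixSum_cons_cons, if_pos hz.le]
      have := ih y z hz hnd'
      simp only [← hP] at this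
      rw [if_congr (decreasing_nonzero_cons_iff w hz) rfl rfl, h1]
      split_ifs with hc
      · rw [if_pos hc] at this
        refine ⟨by rw [this.1, mul_zero], fun a => ?_⟩
        rw [this.1, this.2, List.length_cons (a := x), pow_succ']
        ring
      · rw [if_neg hc] at this
        constructor
        · linear_combination this.1
        · linear_combination t * this.2
    · have hz' : y < z := lt_of_le_of_ne hz (by rintro rfl; simp at hnd')
      have h1 : gammaWeight t (x :: y :: z :: w) = t * gammaWeight t (z :: w) := by
        rw [gammaWeight, gammaWeight, ascPattern_cons_cons, ascPattern_cons_cons]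
        simp [h, hz'.not_gt, patternWeight]
      have h2 : gammaWeight t (y :: z :: w) = 0 := by
        rw [gammaWeight, ascPattern_cons_cons]
        simp [hz'.not_gt, patternWeight_true]
      rw [if_neg]
      · simp only [prefixSum_cons_cons, ge_iff_le, if_neg (not_le.2 hz')]
        rw [h1, h2]
        constructor <;> ring
      · simp [hz']

/-- A word of length at least two starting with an ascent has weight zero and a prefix sum
proportional to a, so the two terms cancel; the preceding lemma handles an initial descent. -/
theorem prefixSum_gammaWeight (t : R) (l : List (Letter r)) (hnd : l.Nodup) :
    prefixSum (· ≥ ·) Finset.univ t (gammaWeight t) l -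
      t * prefixSum (· ≥ ·) Finset.univ 1 (gammaWeight t) l =
      if l.Pairwise (· ≥ ·) ∧ ∀ x ∈ l, x.color ≠ 0 then t ^ l.length - t else 0 := by
  have h3 : gammaWeight t ([] : List (Letter r)) = 1 := rfl
  rcases l with _ | ⟨x, _ | ⟨y, w⟩⟩
  · simp [prefixSum_nil, h3]
  · have h2 : gammaWeight t [x] = 0 := by simp [gammaWeight, ascPattern, patternWeight]
    simp [prefixSum_singleton, h3, h2]
  · rcases lt_or_ge y x with h | h
    · have := prefixSum_gammaWeight_of_lt t x y w h hnd
      split_ifs at this ⊢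
      · rw [this.2, this.2, one_pow, mul_one]
      · rw [this.1, this.2, sub_self]
    · have h' : x < y := lt_of_le_of_ne h (by rintro rfl; simp at hnd)
      have h2 : gammaWeight t (x :: y :: w) = 0 := by
        rw [gammaWeight, ascPattern_cons_cons]
        simp [h'.not_gt, patternWeight_true]
      simp only [prefixSum_cons_cons, ge_iff_le, if_neg (not_le.2 h'), h2]
      rw [if_neg (by simp [h'])]
      ring

end ChainSums

/-! ### Binomial recurrences obtained by summing over all words. -/

section Recurrences

variable {R : Type*} [CommRing R]

theorem sum_words_ascPattern {r : ℕ} (g : List Bool → R) (A : Finset ℕ) :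
    ∑ l ∈ words r A, g (ascPattern l) =
      ∑ w : ColoredPerm A.card r, g (List.ofFn fun k => decide (k ∈ w.Asc)) := by
  rw [sum_words A rfl]
  simp only [ascPattern_word]

/-- The descent enumerator of all colored permutations. -/
def desSum (t : R) (r n : ℕ) : R := ∑ w : ColoredPerm n r, t ^ w.des

/-- The descent enumerator of colored permutations whose first color is zero. -/
def desSumFirstZero (t : R) (r n : ℕ) : R := ∑ w : ColoredPerm n r with w.FirstColorZero, t ^ w.des

/-- The sum of the weights `tⁱ (1 + t)^(n - 2i)` over the colored permutations counted by `ξ⁺`. -/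
def gammaSum (t : R) (r n : ℕ) : R :=
  ∑ w : ColoredPerm n r, patternWeight t (List.ofFn fun k => decide (k ∈ w.Asc))

theorem sum_words_desWeight (t : R) (r : ℕ) (A : Finset ℕ) :
    ∑ l ∈ words r A, desWeight t l = desSum t r A.card := by
  rw [sum_words A rfl]
  simp only [desWeight, count_false_ascPattern, desSum]

theorem desSum_recurrence (t : R) (s n : ℕ) :
    desSum t (s + 1) n - t * ∑ k ∈ Finset.range (n + 1), (n.choose k : R) *
      (((1 - t) * ((s : R) + 1)) ^ k * desSum t (s + 1) (n - k)) = (1 - t) * (1 - t) ^ n := by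
  have h := sum_words_prefixSum (· ≤ ·) (Finset.univ : Finset (Fin (s + 1))) (1 - t) (desWeight t)
    _ (sum_words_desWeight t (s + 1)) (Finset.range n)
  simp only [Finset.card_range, Finset.card_univ, Fintype.card_fin, Nat.cast_add, Nat.cast_one] at h
  have h0 := sum_words_desWeight t (s + 1) (Finset.range n)
  rw [Finset.card_range] at h0
  rw [← h, ← h0, Finset.mul_sum, ← Finset.sum_sub_distrib]
  simp only [desWeight_sub_prefixSum]
  rw [← Finset.sum_filter, Finset.sum_congr rfl (g := fun _ => (1 - t) * (1 - t) ^ n),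
    Finset.sum_const]
  · have := card_sorted_words (r := s + 1) (· ≤ ·) {0} (Finset.range n)
    simp only [Finset.card_singleton, one_pow, Finset.mem_singleton] at this
    rw [Finset.filter_congr (q := fun v => v.Pairwise (· ≤ ·) ∧ ∀ x ∈ v, (ofLex x).1 = 0), this,
      one_smul]
    intro v _
    simp only [Letter.color, Fin.ext_iff, Fin.val_zero]
  · intro v hv
    rw [length_of_mem_words (Finset.mem_filter.1 hv).1, Finset.card_range]

theorem desSumFirstZero_eq (t : R) (s n : ℕ) :
    (1 - t) * desSumFirstZero t (s + 1) n = desSum t (s + 1) n -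
      t * ∑ k ∈ Finset.range (n + 1), (n.choose k : R) *
        (((1 - t) * (s : R)) ^ k * desSum t (s + 1) (n - k)) := by
  have h := sum_words_prefixSum (· ≤ ·) (nonzeroColors (s + 1)) (1 - t) (desWeight t)
    _ (sum_words_desWeight t (s + 1)) (Finset.range n)
  simp only [Finset.card_range, card_nonzeroColors] at h
  have h0 := sum_words_desWeight t (s + 1) (Finset.range n)
  rw [Finset.card_range] at h0
  rw [← h, ← h0, Finset.mul_sum, ← Finset.sum_sub_distrib]
  simp only [desWeight_sub_prefixSum_nonzeroColors]
  rw [sum_words (Finset.range n) (Finset.card_range n), desSumFirstZero, Finset.mul_sum,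
    Finset.sum_filter]
  refine Finset.sum_congr rfl fun w _ => ?_
  rw [desWeight, count_false_ascPattern]
  refine if_congr ?_ rfl rfl
  rcases n with _ | n
  · simp [ColoredPerm.FirstColorZero, ColoredPerm.word]
  · rw [ColoredPerm.word, List.ofFn_succ]
    simp only [List.head?_cons, Option.mem_def, Option.some.injEq, forall_eq',
      ColoredPerm.FirstColorZero]
    constructor
    · intro h
      exact h 0 rfl
    · intro h k hk
      rw [show k = 0 from Fin.ext hk]
      exact h

theorem gammaSum_recurrence (t : R) (s n : ℕ) :
    ∑ k ∈ Finset.range (n + 1), (n.choose k : R) *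
        ((t * ((s : R) + 1)) ^ k * gammaSum t (s + 1) (n - k)) -
      t * ∑ k ∈ Finset.range (n + 1), (n.choose k : R) *
        (((s : R) + 1) ^ k * gammaSum t (s + 1) (n - k)) = (t * s) ^ n - t * (s : R) ^ n := by
  have h := fun a => sum_words_prefixSum (· ≥ ·) (Finset.univ : Finset (Fin (s + 1))) a
    (gammaWeight t) (gammaSum t (s + 1)) (sum_words_ascPattern (patternWeight t)) (Finset.range n)
  have h1 := h t
  have h2 := h 1
  simp only [Finset.card_range, Finset.card_univ, Fintype.card_fin, Nat.cast_add, Nat.cast_one,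
    one_mul] at h1 h2
  rw [← h1, ← h2, Finset.mul_sum, ← Finset.sum_sub_distrib]
  rw [Finset.sum_congr rfl fun l hl => prefixSum_gammaWeight t l
    (List.Nodup.of_map _ (mem_words.1 hl).1)]
  rw [← Finset.sum_filter, Finset.sum_congr rfl (g := fun _ => t ^ n - t), Finset.sum_const]
  · have := card_sorted_words (r := s + 1) (· ≥ ·) (nonzeroColors (s + 1)) (Finset.range n)
    rw [card_nonzeroColors, Finset.card_range] at this
    rw [Finset.filter_congr (q := fun v => v.Pairwise (· ≥ ·) ∧
      ∀ x ∈ v, (ofLex x).1 ∈ nonzeroColors (s + 1)), this, nsmul_eq_mul]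
    · push_cast
      ring
    · intro v _
      simp only [Letter.color, nonzeroColors, Finset.mem_filter, Finset.mem_univ, true_and]
  · intro v hv
    rw [length_of_mem_words (Finset.mem_filter.1 hv).1, Finset.card_range]

end Recurrences

/-! ### From the recursive pattern weight to the definition of d⁺. -/

section GammaExpansion

/-- An ascent pattern whose ascents are not at the first position, include the last position and
are pairwise nonconsecutive. -/
def AdmissiblePattern (l : List Bool) : Prop :=
  l.head? ≠ some true ∧ l.getLast? = some true ∧ l.IsChain fun a b => ¬ (a = true ∧ b = true)

instance : DecidablePred AdmissiblePattern := fun _ => inferInstanceAs (Decidable (_ ∧ _))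

theorem admissiblePattern_pair : AdmissiblePattern [false, true] := by
  simp [AdmissiblePattern]

theorem not_admissiblePattern_true (l : List Bool) : ¬ AdmissiblePattern (true :: l) := by
  simp [AdmissiblePattern]

theorem not_admissiblePattern_singleton (b : Bool) : ¬ AdmissiblePattern [b] := by
  cases b <;> simp [AdmissiblePattern]

theorem admissiblePattern_false_true_cons (b : Bool) (l : List Bool) :
    AdmissiblePattern (false :: true :: b :: l) ↔ AdmissiblePattern (b :: l) := by
  cases b <;> simp [AdmissiblePattern]

theorem admissiblePattern_false_false_cons (l : List Bool) :
    AdmissiblePattern (false :: false :: l) ↔ AdmissiblePattern (false :: l) := by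
  simp [AdmissiblePattern]

/-- Each ascent is immediately preceded by a descent of its own. The bounds are the limits of
summation in `dPlus` and make the exponent n - 2i a genuine subtraction. -/
theorem AdmissiblePattern.count_bounds {l : List Bool} (h : AdmissiblePattern l) :
    1 ≤ l.count true ∧ 2 * l.count true ≤ l.length := by
  induction l using patternWeight.induct with
  | case1 => simp [AdmissiblePattern] at h
  | case2 b => exact absurd h (not_admissiblePattern_singleton b)
  | case3 l => exact absurd h (not_admissiblePattern_true _)
  | case4 l ih =>
    rcases l with _ | ⟨b, l⟩
    · simp
    · have := ih ((admissiblePattern_false_true_cons b l).1 h)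
      have hc : (false :: true :: b :: l).count true = (b :: l).count true + 1 := by simp
      simp only [hc, List.length_cons] at this ⊢
      omega
  | case5 l ih =>
    have := ih ((admissiblePattern_false_false_cons l).1 h)
    have hc : (false :: false :: l).count true = (false :: l).count true := by simp
    simp only [hc, List.length_cons] at this ⊢
    omega

/-- The empty pattern is excluded: it has weight 1, matching d⁺ for n = 0, but is not admissible. -/
theorem patternWeight_eq {R : Type*} [CommRing R] (t : R) (l : List Bool) (hl : l ≠ []) :
    patternWeight t l = if AdmissiblePattern l then
      t ^ l.count true * (1 + t) ^ (l.length - 2 * l.count true) else 0 := by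
  induction l using patternWeight.induct with
  | case1 => exact absurd rfl hl
  | case2 b => rw [if_neg (not_admissiblePattern_singleton b), patternWeight]
  | case3 l => rw [if_neg (not_admissiblePattern_true _), patternWeight_true]
  | case4 l ih =>
    rcases l with _ | ⟨b, l⟩
    · simp [admissiblePattern_pair, patternWeight]
    · rw [patternWeight, ih (by simp), if_congr (admissiblePattern_false_true_cons b l) rfl rfl]
      have hc : (false :: true :: b :: l).count true = (b :: l).count true + 1 := by simp
      have hlen : (false :: true :: b :: l).length - 2 * ((b :: l).count true + 1) =
          (b :: l).length - 2 * (b :: l).count true := by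
        simp only [List.length_cons]
        omega
      rw [hc, hlen, mul_ite, mul_zero, pow_succ']
      split_ifs <;> ring
  | case5 l ih =>
    rw [patternWeight, ih (by simp), if_congr (admissiblePattern_false_false_cons l) rfl rfl]
    split_ifs with h
    · have hb := h.count_bounds.2
      have hc : (false :: false :: l).count true = (false :: l).count true := by simp
      have hlen : (false :: false :: l).length - 2 * (false :: l).count true =
          ((false :: l).length - 2 * (false :: l).count true) + 1 := by
        rw [List.length_cons]
        omega
      rw [hc, hlen, pow_succ']
      ring
    · rw [mul_zero]

theorem ascCondition_iff {n r i : ℕ} (w : ColoredPerm n r) :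
    w.AscCondition i ↔ AdmissiblePattern (List.ofFn fun k => decide (k ∈ w.Asc)) ∧
      w.Asc.card = i := by
  have h1 : (∀ k ∈ w.Asc, (k : ℕ) ≠ 0) ↔
      (List.ofFn fun k => decide (k ∈ w.Asc)).head? ≠ some true := by
    rcases n with _ | n
    · simp
    · rw [List.ofFn_succ]
      simp only [List.head?_cons, ne_eq, Option.some.injEq, decide_eq_true_eq]
      constructor
      · intro h h0
        exact h 0 h0 rfl
      · intro h k hk hk0
        rw [show k = 0 from Fin.ext hk0] at hk
        exact h hk
  have h2 : (∃ k ∈ w.Asc, (k : ℕ) + 1 = n) ↔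
      (List.ofFn fun k => decide (k ∈ w.Asc)).getLast? = some true := by
    rcases n with _ | n
    · simp
    · rw [List.ofFn_succ']
      simp only [List.concat_eq_append, List.getLast?_concat, Option.some.injEq, decide_eq_true_eq]
      constructor
      · rintro ⟨k, hk, hk'⟩
        rwa [show k = Fin.last n from Fin.ext (by simpa using hk')] at hk
      · intro h
        exact ⟨_, h, by simp⟩
  have h3 : (∀ j ∈ w.Asc, ∀ k ∈ w.Asc, (k : ℕ) ≠ (j : ℕ) + 1) ↔
      (List.ofFn fun k => decide (k ∈ w.Asc)).IsChain fun a b => ¬ (a = true ∧ b = true) := by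
    rw [List.isChain_iff_getElem]
    simp only [List.getElem_ofFn, decide_eq_true_eq, List.length_ofFn]
    constructor
    · intro h i hi hij
      exact h _ hij.1 _ hij.2 rfl
    · intro h j hj k hk hjk
      refine h j (by omega) ⟨hj, ?_⟩
      rwa [show k = ⟨j + 1, hjk ▸ k.2⟩ from Fin.ext hjk] at hk
  rw [ColoredPerm.AscCondition, AdmissiblePattern, h1, h2, h3]
  tauto

theorem gammaSum_X (n r : ℕ) : gammaSum (X : ℤ[X]) r n = dPlus n r := by
  rw [dPlus, gammaSum]
  split_ifs with hn
  · subst hn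
    have : ∀ w : ColoredPerm 0 r, patternWeight (X : ℤ[X])
        (List.ofFn fun k => decide (k ∈ w.Asc)) = 1 := fun w => by
      simp [patternWeight]
    rw [Finset.sum_congr rfl fun w _ => this w]
    simp
  · have hcount : ∀ w : ColoredPerm n r,
        (List.ofFn fun k => decide (k ∈ w.Asc)).count true = w.Asc.card := by
      intro w
      rw [count_ofFn]
      congr 1
      ext k
      simp
    have hw : ∀ w : ColoredPerm n r, patternWeight (X : ℤ[X])
        (List.ofFn fun k => decide (k ∈ w.Asc)) = ∑ i ∈ Finset.Icc 1 (n / 2),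
          if w.AscCondition i then X ^ i * (1 + X) ^ (n - 2 * i) else 0 := by
      intro w
      rw [patternWeight_eq _ _ (by simp [hn])]
      split_ifs with h
      · have hb := h.count_bounds
        rw [hcount, List.length_ofFn] at hb ⊢
        rw [Finset.sum_eq_single_of_mem w.Asc.card (Finset.mem_Icc.2 ⟨hb.1, by omega⟩)]
        · rw [if_pos ((ascCondition_iff w).2 ⟨h, rfl⟩)]
        · intro i _ hi
          rw [if_neg]
          intro h'
          exact hi ((ascCondition_iff w).1 h').2.symm
      · refine (Finset.sum_eq_zero fun i _ => ?_).symm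
        rw [if_neg]
        intro h'
        exact h ((ascCondition_iff w).1 h').1
    simp only [hw]
    rw [Finset.sum_comm]
    refine Finset.sum_congr rfl fun i _ => ?_
    rw [← Finset.sum_filter, Finset.sum_const, nsmul_eq_mul, xiPlus, mul_assoc]

end GammaExpansion

/-! ### Transfer to rational power series; part (b) and the descent formula. -/

section Transfer

/-- The inclusion of `ℤ[t]` into `ℚ⟦t⟧`. -/
noncomputable def toRatSeries : ℤ[X] →+* PowerSeries ℚ :=
  (Polynomial.coeToPowerSeries.ringHom (R := ℚ)).comp (Polynomial.mapRingHom (Int.castRingHom ℚ))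

theorem toRatSeries_apply (p : ℤ[X]) :
    toRatSeries p = ((p.map (Int.castRingHom ℚ) : ℚ[X]) : PowerSeries ℚ) := rfl

theorem toRatSeries_injective : Function.Injective toRatSeries := by
  intro p q h
  rw [toRatSeries_apply, toRatSeries_apply, Polynomial.coe_inj] at h
  exact Polynomial.map_injective _ (RingHom.injective_int _) h

theorem toRatSeries_X : toRatSeries X = PowerSeries.X := by
  simp [toRatSeries_apply]

theorem map_patternWeight {R S : Type*} [CommRing R] [CommRing S] (φ : R →+* S) (t : R)
    (l : List Bool) : φ (patternWeight t l) = patternWeight (φ t) l := by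
  fun_induction patternWeight t l <;> simp_all [patternWeight, patternWeight_true]

theorem map_gammaSum {R S : Type*} [CommRing R] [CommRing S] (φ : R →+* S) (t : R) (r n : ℕ) :
    φ (gammaSum t r n) = gammaSum (φ t) r n := by
  simp only [gammaSum, map_sum, map_patternWeight]

theorem X_ne_one_powerSeries : (PowerSeries.X : PowerSeries ℚ) ≠ 1 := by
  intro h
  have := congrArg (PowerSeries.coeff 0) h
  simp at this

theorem toRatSeries_APlus (n : ℕ) {r : ℕ} (hr : 0 < r) :
    toRatSeries (APlus n r) = eulerianSeries r n := by
  obtain ⟨s, rfl⟩ : ∃ s, r = s + 1 := ⟨r - 1, by omega⟩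
  have h := hasEulerianEGF_eulerianSeries (s + 1)
  rw [Nat.cast_add, Nat.cast_one] at h
  refine congrFun (HasEulerianEGF.unique X_ne_one_powerSeries
    (a := fun n => toRatSeries (APlus n (s + 1))) ?_ h) n
  refine hasEulerianEGF_of_gamma (s : PowerSeries ℚ)
    (gammaSum_recurrence PowerSeries.X s) fun m => ?_
  simp only [APlus, map_sum, map_mul, map_natCast, one_pow, mul_one, ← gammaSum_X, map_gammaSum,
    toRatSeries_X]

theorem toRatSeries_desSumFirstZero (n : ℕ) {r : ℕ} (hr : 0 < r) :
    toRatSeries (∑ w : ColoredPerm n r with w.FirstColorZero, X ^ w.des) = eulerianSeries r n := by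
  obtain ⟨s, rfl⟩ : ∃ s, r = s + 1 := ⟨r - 1, by omega⟩
  have h := hasEulerianEGF_eulerianSeries (s + 1)
  rw [Nat.cast_add, Nat.cast_one] at h
  have h1 := hasEulerianEGF_of_descents X_ne_one_powerSeries (s : PowerSeries ℚ)
    (desSum_recurrence PowerSeries.X s) (desSumFirstZero_eq PowerSeries.X s)
  rw [← congrFun (HasEulerianEGF.unique X_ne_one_powerSeries h1 h) n, desSumFirstZero]
  simp only [map_sum, map_pow, toRatSeries_X]

theorem eulerianSeries_of_pos (r : ℕ) {n : ℕ} (hn : 0 < n) :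
    eulerianSeries r n = (1 - PowerSeries.X) ^ n *
      PowerSeries.mk fun k : ℕ => ((r : ℚ) * k + 1) ^ n - ((r : ℚ) * k) ^ n := by
  rw [eulerianSeries, zero_pow hn.ne', zero_add]
  congr 1
  ext k
  simp [linearPowSeries]

theorem toRatSeries_mul_inv (n : ℕ) {r : ℕ} (hn : 0 < n) (hr : 0 < r) :
    ((((APlus n r).map (Int.castRingHom ℚ) : ℚ[X]) : PowerSeries ℚ) *
        ((1 - PowerSeries.X) ^ n)⁻¹ =
      PowerSeries.mk fun k : ℕ => ((r : ℚ) * k + 1) ^ n - ((r : ℚ) * k) ^ n) := by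
  rw [← toRatSeries_apply, toRatSeries_APlus n hr, eulerianSeries_of_pos r hn, mul_comm, ← mul_assoc,
    PowerSeries.inv_mul_cancel _ (by simp), one_mul]

end Transfer

/-! ### The Eulerian identity for excedances. -/

section Excedances

/-- The number of excedances of a permutation. -/
def excedances {n : ℕ} (σ : Equiv.Perm (Fin n)) : ℕ := (Finset.univ.filter fun k => k < σ k).card

theorem excedances_eq_sum {n : ℕ} (σ : Equiv.Perm (Fin n)) :
    excedances σ = ∑ k, if k < σ k then 1 else 0 := by
  rw [excedances, Finset.card_filter]

theorem excedances_decomposeFin_zero {n : ℕ} (e : Equiv.Perm (Fin n)) :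
    excedances (Equiv.Perm.decomposeFin.symm (0, e)) = excedances e := by
  rw [excedances_eq_sum, Fin.sum_univ_succ, excedances_eq_sum]
  simp [Equiv.Perm.decomposeFin_symm_apply_succ]

/-- The new permutation sends 0 to `y.succ`, sends the successor of the preimage of y to 0, and
otherwise copies e. It gains an excedance at 0 and loses one exactly when `e.symm y < y`. -/
theorem excedances_decomposeFin_succ {n : ℕ} (y : Fin n) (e : Equiv.Perm (Fin n)) :
    excedances (Equiv.Perm.decomposeFin.symm (y.succ, e)) + (if e.symm y < y then 1 else 0) =
      excedances e + 1 := by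
  have h1 : ∀ x : Fin n, (if x.succ < Equiv.Perm.decomposeFin.symm (y.succ, e) x.succ then 1 else 0)
      + (if e x = y then (if x < e x then 1 else 0) else 0) = if x < e x then 1 else 0 := by
    intro x
    rw [Equiv.Perm.decomposeFin_symm_apply_succ]
    by_cases h : e x = y
    · simp [h]
    · rw [Equiv.swap_apply_of_ne_of_ne (Fin.succ_ne_zero _) (by simpa using h)]
      simp [h]
  have h2 : ∑ x, (if e x = y then (if x < e x then 1 else 0) else 0) =
      if e.symm y < y then 1 else 0 := by
    rw [Finset.sum_eq_single (e.symm y)]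
    · simp
    · intro x _ hx
      rw [if_neg]
      rintro rfl
      simp at hx
    · simp
  rw [excedances_eq_sum, Fin.sum_univ_succ, ← h2, excedances_eq_sum, add_assoc,
    ← Finset.sum_add_distrib, Finset.sum_congr rfl fun x _ => h1 x,
    Equiv.Perm.decomposeFin_symm_apply_zero]
  simp [add_comm]

theorem sum_pow_excedances_decomposeFin {R : Type*} [CommRing R] (t : R) {n : ℕ}
    (e : Equiv.Perm (Fin n)) :
    ∑ p, t ^ excedances (Equiv.Perm.decomposeFin.symm (p, e)) =
      t ^ excedances e * (1 + excedances e + (n - excedances e) * t) := by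
  have h1 : ∀ y : Fin n, t ^ excedances (Equiv.Perm.decomposeFin.symm (y.succ, e)) =
      t ^ excedances e * (t + (if e.symm y < y then 1 - t else 0)) := by
    intro y
    have := excedances_decomposeFin_succ y e
    split_ifs at this ⊢ with h
    · rw [add_right_cancel this]
      ring
    · rw [add_zero] at this
      rw [this]
      ring
  have h2 : (Finset.univ.filter fun y => e.symm y < y).card = excedances e := by
    rw [excedances]
    refine Finset.card_bij (fun y _ => e.symm y) ?_ ?_ ?_
    · simp
    · simp
    · intro x hx
      exact ⟨e x, by simpa using hx, by simp⟩
  rw [Fin.sum_univ_succ, excedances_decomposeFin_zero, Finset.sum_congr rfl fun y _ => h1 y,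
    ← Finset.mul_sum, Finset.sum_add_distrib, ← Finset.sum_filter, Finset.sum_const,
    Finset.sum_const, h2, Finset.card_univ, Fintype.card_fin, nsmul_eq_mul, nsmul_eq_mul]
  ring

/-- Inserting a new first point gives the Eulerian recurrence A_{n+1} = (1 + nt) A_n + t(1-t) A_n'.
The right-hand side satisfies it because S_n = Σ (k+1)^n t^k obeys S_{n+1} = S_n + t S_n'. -/
theorem sum_X_pow_excedances (n : ℕ) :
    ∑ σ : Equiv.Perm (Fin n), (PowerSeries.X : PowerSeries ℚ) ^ excedances σ =
      (1 - PowerSeries.X) ^ (n + 1) * linearPowSeries 1 1 n := by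
  induction n with
  | zero =>
    have h := linearPowSeries_sub_X_mul 1 1 0
    have h' : linearPowSeries 1 (1 + 1) 0 = linearPowSeries 1 1 0 := by
      simp [linearPowSeries]
    rw [h'] at h
    simp only [pow_zero, map_one] at h
    have : ∀ σ : Equiv.Perm (Fin 0), excedances σ = 0 := fun σ => by simp [excedances]
    simp only [this]
    simp
    linear_combination -h
  | succ n ih =>
    have hS : linearPowSeries 1 1 (n + 1) = linearPowSeries 1 1 n +
        PowerSeries.X * PowerSeries.derivative ℚ (linearPowSeries 1 1 n) := by
      ext k
      rcases k with _ | k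
      · simp [linearPowSeries]
      · rw [map_add, PowerSeries.coeff_succ_X_mul, PowerSeries.coeff_derivative]
        simp only [linearPowSeries, PowerSeries.coeff_mk]
        push_cast
        ring
    have hX : ∀ e : ℕ, (PowerSeries.X : PowerSeries ℚ) *
        PowerSeries.derivative ℚ (PowerSeries.X ^ e : PowerSeries ℚ) =
        (e : PowerSeries ℚ) * (PowerSeries.X ^ e : PowerSeries ℚ) := by
      intro e
      rcases e with _ | e
      · simp
      · rw [Derivation.leibniz_pow, PowerSeries.derivative_X]
        simp
        ring
    have hsum : ∑ σ : Equiv.Perm (Fin (n + 1)), (PowerSeries.X : PowerSeries ℚ) ^ excedances σ =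
        (1 + (n : PowerSeries ℚ) * PowerSeries.X) * ∑ σ : Equiv.Perm (Fin n), PowerSeries.X ^ excedances σ +
        (1 - PowerSeries.X) * (PowerSeries.X * PowerSeries.derivative ℚ
          (∑ σ : Equiv.Perm (Fin n), PowerSeries.X ^ excedances σ)) := by
      rw [← Equiv.Perm.decomposeFin.symm.sum_comp, Fintype.sum_prod_type_right, map_sum,
        Finset.mul_sum, Finset.mul_sum, Finset.mul_sum, ← Finset.sum_add_distrib]
      refine Finset.sum_congr rfl fun e _ => ?_
      rw [sum_pow_excedances_decomposeFin, hX]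
      ring
    have hd : PowerSeries.derivative ℚ ((1 - PowerSeries.X : PowerSeries ℚ) ^ (n + 1)) =
        -(((n : PowerSeries ℚ) + 1) * (1 - PowerSeries.X) ^ n) := by
      rw [Derivation.leibniz_pow, map_sub, PowerSeries.derivative_X]
      simp
    rw [hsum, ih, hS, Derivation.leibniz, hd]
    simp only [smul_eq_mul]
    ring

end Excedances

/-! ### Flag excedances and extraction of exponents divisible by r. -/

section FlagExcedances

/-- For fixed σ the sum over colors factors over positions. A position with k < σ k contributes t^r
+ t + … + t^{r-1} = t (1 + … + t^{r-1}), any other 1 + … + t^{r-1}. -/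
theorem sum_pow_fexc {R : Type*} [CommRing R] (t : R) (n r : ℕ) :
    ∑ w : ColoredPerm n r, t ^ w.fexc =
      (∑ c ∈ Finset.range r, t ^ c) ^ n * ∑ σ : Equiv.Perm (Fin n), t ^ excedances σ := by
  have hfexc : ∀ (σ : Equiv.Perm (Fin n)) (ε : Fin n → Fin r), t ^ ColoredPerm.fexc (σ, ε) =
      ∏ k, t ^ ((if k < σ k ∧ (ε k : ℕ) = 0 then r else 0) + (ε k : ℕ)) := by
    intro σ ε
    rw [Finset.prod_pow_eq_pow_sum, Finset.sum_add_distrib, ← Finset.sum_filter, Finset.sum_const,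
      ColoredPerm.fexc, ColoredPerm.excA, ColoredPerm.colorSum, smul_eq_mul, mul_comm]
  have hcolor : ∀ p : Prop, ∀ _ : Decidable p,
      ∑ c : Fin r, t ^ ((if p ∧ (c : ℕ) = 0 then r else 0) + (c : ℕ)) =
        (∑ c ∈ Finset.range r, t ^ c) * if p then t else 1 := by
    intro p _
    rw [Fin.sum_univ_eq_sum_range fun c => t ^ ((if p ∧ c = 0 then r else 0) + c)]
    split_ifs with hp
    · rcases r with _ | s
      · simp
      · rw [Finset.sum_range_succ', Finset.sum_mul, Finset.sum_range_succ]
        simp [hp, pow_succ]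
    · simp [hp]
  rw [Fintype.sum_prod_type, Finset.mul_sum]
  refine Finset.sum_congr rfl fun σ _ => ?_
  simp only [hfexc]
  rw [← Fintype.prod_sum fun (k : Fin n) (c : Fin r) =>
    t ^ ((if k < σ k ∧ (c : ℕ) = 0 then r else 0) + (c : ℕ))]
  rw [Finset.prod_congr rfl fun k _ => hcolor (k < σ k) _, Finset.prod_mul_distrib,
    Finset.prod_const, Finset.card_univ, Fintype.card_fin, Finset.prod_ite, Finset.prod_const,
    Finset.prod_const_one, mul_one, excedances]

/-- The power series formed by the coefficients of `f` whose indices are multiples of `r`. -/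
noncomputable def sectionSeries (r : ℕ) (f : PowerSeries ℚ) : PowerSeries ℚ :=
  PowerSeries.mk fun k => PowerSeries.coeff (r * k) f

/-- Under extraction of the indices divisible by r, multiplication by t^r becomes multiplication by
t. -/
theorem sectionSeries_one_sub_X_pow_mul {r : ℕ} (hr : 0 < r) (n : ℕ) (f : PowerSeries ℚ) :
    sectionSeries r ((1 - PowerSeries.X ^ r) ^ n * f) =
      (1 - PowerSeries.X) ^ n * sectionSeries r f := by
  induction n generalizing f with
  | zero => simp
  | succ n ih =>
    rw [pow_succ, mul_assoc, ih, pow_succ, mul_assoc]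
    congr 1
    ext k
    rw [sectionSeries, PowerSeries.coeff_mk, sub_mul, one_mul, map_sub, sub_mul, one_mul, map_sub,
      PowerSeries.coeff_X_pow_mul']
    rcases k with _ | k
    · simp [sectionSeries, hr.ne']
    · rw [PowerSeries.coeff_succ_X_mul, if_pos (Nat.le_mul_of_pos_right r k.succ_pos)]
      simp [sectionSeries, Nat.mul_succ]

theorem dvd_fexc_iff {n r : ℕ} (w : ColoredPerm n r) : r ∣ w.fexc ↔ r ∣ w.colorSum := by
  rw [ColoredPerm.fexc]
  exact Nat.dvd_add_right (Nat.dvd_mul_right _ _)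

theorem toRatSeries_fexcSum {n r : ℕ} (hn : 0 < n) (hr : 0 < r) :
    toRatSeries (∑ w : ColoredPerm n r with r ∣ w.colorSum, X ^ (w.fexc / r)) =
      eulerianSeries r n := by
  have h1 : toRatSeries (∑ w : ColoredPerm n r with r ∣ w.colorSum, X ^ (w.fexc / r)) =
      sectionSeries r (∑ w : ColoredPerm n r, PowerSeries.X ^ w.fexc) := by
    ext k
    rw [map_sum, map_sum, sectionSeries, PowerSeries.coeff_mk, map_sum, Finset.sum_filter]
    refine Finset.sum_congr rfl fun w _ => ?_
    rw [map_pow, toRatSeries_X, PowerSeries.coeff_X_pow, PowerSeries.coeff_X_pow, ← ite_and]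
    refine if_congr ?_ rfl rfl
    rw [← dvd_fexc_iff]
    constructor
    · rintro ⟨h, rfl⟩
      rw [Nat.mul_div_cancel' h]
    · intro h
      rw [← h]
      exact ⟨Nat.dvd_mul_right _ _, (Nat.mul_div_cancel_left _ hr).symm⟩
  -- Here (1 + … + t^{r-1})^n absorbs n of the n+1 factors 1-t; the remaining one turns the powers
  -- (k+1)^n into differences.
  have h2 : (∑ c ∈ Finset.range r, (PowerSeries.X : PowerSeries ℚ) ^ c) ^ n *
      ((1 - PowerSeries.X) ^ (n + 1) * linearPowSeries 1 1 n) =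
      (1 - PowerSeries.X ^ r) ^ n * ((1 - PowerSeries.X) * linearPowSeries 1 1 n) := by
    rw [← geom_sum_mul_neg, mul_pow]
    ring
  rw [h1, sum_pow_fexc, sum_X_pow_excedances, h2, sectionSeries_one_sub_X_pow_mul hr,
    eulerianSeries_of_pos r hn]
  congr 1
  ext k
  have h3 : (1 - PowerSeries.X) * linearPowSeries 1 1 n =
      PowerSeries.mk fun k : ℕ => ((k : ℚ) + 1) ^ n - (k : ℚ) ^ n := by
    ext k
    rcases k with _ | k
    · simp [linearPowSeries, hn.ne']
    · rw [sub_mul, one_mul, map_sub, PowerSeries.coeff_succ_X_mul]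
      simp [linearPowSeries]
  rw [h3]
  simp [sectionSeries]

end FlagExcedances

/-! ### Hilbert series and h-polynomials. -/

namespace AbstractSimplicialComplex

section HilbertSeries

variable {W : Type*} [Fintype W]

/-- The maps from the vertices to `ℕ` which are supported on a face or empty and have sum `k`. -/
def supportedMaps (K : AbstractSimplicialComplex W) (k : ℕ) : Set (W → ℕ) :=
  {g | (supp g = ∅ ∨ supp g ∈ K.faces) ∧ ∑ v, g v = k}

theorem mem_supp {g : W → ℕ} {v : W} : v ∈ supp g ↔ g v ≠ 0 := by
  simp [supp]

theorem finite_sum_eq (k : ℕ) : {g : W → ℕ | ∑ v, g v = k}.Finite := by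
  refine Set.Finite.subset (Set.Finite.pi' fun _ => Set.finite_Iic k) fun g hg v => ?_
  rw [Set.mem_ofPred_eq] at hg
  rw [Set.mem_Iic, ← hg]
  exact Finset.single_le_sum (fun _ _ => Nat.zero_le _) (Finset.mem_univ v)

/-- The series is (t/(1-t))^|F|: one independent positive exponent for each vertex of F. -/
theorem coeff_geom_pow [DecidableEq W] (F : Finset W) (k : ℕ) :
    PowerSeries.coeff k ((PowerSeries.X * PowerSeries.mk fun _ => (1 : ℚ)) ^ F.card) =
      ({g : W → ℕ | supp g = F ∧ ∑ v, g v = k}.ncard : ℚ) := by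
  rw [← Finset.prod_const, PowerSeries.coeff_prod]
  have h1 : ∀ m : ℕ, PowerSeries.coeff m (PowerSeries.X * PowerSeries.mk fun _ => (1 : ℚ)) =
      if m ≠ 0 then 1 else 0 := by
    intro m
    rcases m with _ | m
    · simp
    · simp [PowerSeries.coeff_succ_X_mul]
  simp only [h1, Finset.prod_ite_zero, Finset.prod_const_one]
  rw [← Finset.sum_filter, Finset.sum_const, nsmul_eq_mul, mul_one, ← Set.ncard_coe_finset]
  congr 1
  refine Set.ncard_congr (fun l _ => ⇑l) ?_ ?_ ?_
  · intro l hl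
    simp only [Finset.coe_filter, Finset.mem_finsuppAntidiag, Set.mem_ofPred_eq] at hl ⊢
    obtain ⟨⟨hsum, hsub⟩, hne⟩ := hl
    constructor
    · ext v
      rw [mem_supp]
      exact ⟨fun h => hsub (Finsupp.mem_support_iff.2 h), fun h => hne v h⟩
    · rw [← hsum]
      refine (Finset.sum_subset (Finset.subset_univ _) fun v _ hv => ?_).symm
      by_contra h
      exact hv (hsub (Finsupp.mem_support_iff.2 h))
  · intro l l' _ _ h
    exact DFunLike.coe_injective h
  · rintro g ⟨rfl, hg⟩
    refine ⟨Finsupp.equivFunOnFinite.symm g, ?_, by simp⟩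
    simp only [Finset.coe_filter, Finset.mem_finsuppAntidiag, Set.mem_ofPred_eq]
    refine ⟨⟨?_, ?_⟩, fun v hv => mem_supp.1 hv⟩
    · rw [← hg]
      refine Finset.sum_subset (Finset.subset_univ _) fun v _ hv => ?_
      by_contra h
      exact hv (mem_supp.2 h)
    · intro v hv
      exact mem_supp.2 (Finsupp.mem_support_iff.1 hv)

theorem card_le_rank (K : AbstractSimplicialComplex W) {s : Finset W} (hs : s ∈ K.faces) :
    s.card ≤ K.rank := by
  refine le_csSup ⟨Fintype.card W, ?_⟩ ⟨s, hs, rfl⟩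
  rintro m ⟨s, -, rfl⟩
  exact Finset.card_le_univ s

theorem faceCount_rank_ne_zero (K : AbstractSimplicialComplex W) : K.faceCount K.rank ≠ 0 := by
  rw [faceCount, ← Nat.pos_iff_ne_zero, Set.ncard_pos (Set.toFinite _)]
  rcases Set.eq_empty_or_nonempty {m : ℕ | ∃ s ∈ K.faces, s.card = m} with h | h
  · refine ⟨∅, Or.inl rfl, ?_⟩
    rw [rank, h]
    simp
  · obtain ⟨s, hs, h1⟩ := Nat.sSup_mem h ⟨Fintype.card W, by
      rintro m ⟨s, -, rfl⟩
      exact Finset.card_le_univ s⟩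
    exact ⟨s, Or.inr hs, h1⟩

/-- At t = 1 only the top term survives, leaving the number of faces of maximal size. -/
theorem eval_one_hPolynomial (K : AbstractSimplicialComplex W) : K.hPolynomial.eval 1 ≠ 0 := by
  have : K.hPolynomial.eval 1 = K.faceCount K.rank := by
    rw [hPolynomial, eval_finsetSum, Finset.sum_range_succ, Finset.sum_eq_zero]
    · simp
    · intro i hi
      have : K.rank - i ≠ 0 := by
        have := Finset.mem_range.1 hi
        omega
      simp [this]
  rw [this]
  exact_mod_cast K.faceCount_rank_ne_zero

/-- The Hilbert series of the Stanley–Reisner ring. -/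
noncomputable def hilbertSeries (K : AbstractSimplicialComplex W) : PowerSeries ℚ :=
  PowerSeries.mk fun k => ((K.supportedMaps k).ncard : ℚ)

open Classical in
-- Grouping the maps by support gives Σ_F (t/(1-t))^|F| over all faces, the empty one included.
theorem hilbertSeries_mul (K : AbstractSimplicialComplex W) :
    K.hilbertSeries * (1 - PowerSeries.X) ^ K.rank = toRatSeries K.hPolynomial := by
  set Fs : Finset (Finset W) := Finset.univ.filter fun s => s = ∅ ∨ s ∈ K.faces with hFs
  have hH : K.hilbertSeries =
      ∑ F ∈ Fs, (PowerSeries.X * PowerSeries.mk fun _ => (1 : ℚ)) ^ F.card := by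
    ext k
    rw [map_sum, Finset.sum_congr rfl fun F _ => coeff_geom_pow F k, hilbertSeries,
      PowerSeries.coeff_mk, ← Nat.cast_sum]
    congr 1
    have hfin := finite_sum_eq (W := W) k
    have h1 : K.supportedMaps k =
        ((hfin.toFinset.filter fun g => supp g ∈ Fs : Finset (W → ℕ)) : Set (W → ℕ)) := by
      ext g
      simp [supportedMaps, hFs, and_comm]
    have h2 : ∀ F : Finset W, {g : W → ℕ | supp g = F ∧ ∑ v, g v = k} =
        ((hfin.toFinset.filter fun g => supp g = F : Finset (W → ℕ)) : Set (W → ℕ)) := by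
      intro F
      ext g
      simp [and_comm]
    simp only [h1, h2, Set.ncard_coe_finset]
    rw [Finset.card_eq_sum_card_fiberwise (f := supp) (t := Fs)]
    · refine Finset.sum_congr rfl fun F hF => ?_
      congr 1
      ext g
      simp only [Finset.mem_filter]
      constructor
      · rintro ⟨⟨h, -⟩, h'⟩
        exact ⟨h, h'⟩
      · rintro ⟨h, rfl⟩
        exact ⟨⟨h, hF⟩, rfl⟩
    · intro g hg
      exact (Finset.mem_filter.1 hg).2
  have hunit : (PowerSeries.mk fun _ => (1 : ℚ)) * (1 - PowerSeries.X) = 1 :=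
    PowerSeries.mk_one_mul_one_sub_eq_one ℚ
  have hle : ∀ F ∈ Fs, F.card ≤ K.rank := by
    intro F hF
    rcases (Finset.mem_filter.1 hF).2 with rfl | h
    · simp
    · exact K.card_le_rank h
  have hterm : ∀ F ∈ Fs, (PowerSeries.X * PowerSeries.mk fun _ => (1 : ℚ)) ^ F.card *
      (1 - PowerSeries.X) ^ K.rank =
      PowerSeries.X ^ F.card * (1 - PowerSeries.X) ^ (K.rank - F.card) := by
    intro F hF
    conv_lhs => rw [← Nat.add_sub_cancel' (hle F hF), pow_add, mul_pow]
    rw [mul_assoc, ← mul_assoc _ _ ((1 - PowerSeries.X) ^ (K.rank - F.card)), ← mul_pow, hunit,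
      one_pow, one_mul]
  rw [hH, Finset.sum_mul, Finset.sum_congr rfl hterm,
    ← Finset.sum_fiberwise_of_maps_to (t := Finset.range (K.rank + 1)) (g := Finset.card)
      fun F hF => Finset.mem_range.2 (Nat.lt_succ_of_le (hle F hF)), hPolynomial, map_sum]
  refine Finset.sum_congr rfl fun i _ => ?_
  have hc : K.faceCount i = (Fs.filter fun F => F.card = i).card := by
    rw [faceCount, ← Set.ncard_coe_finset]
    congr 1
    ext s
    simp [hFs]
  rw [Finset.sum_congr rfl (g := fun _ => PowerSeries.X ^ i * (1 - PowerSeries.X) ^ (K.rank - i)),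
    Finset.sum_const, hc, nsmul_eq_mul]
  · simp only [map_mul, map_pow, map_sub, map_one, map_natCast, toRatSeries_X, mul_assoc]
  · intro F hF
    rw [(Finset.mem_filter.1 hF).2]

/-- The `h`-polynomial is determined by the Hilbert series, whatever the dimension is. -/
theorem hPolynomial_eq_of_hilbertSeries (K : AbstractSimplicialComplex W) (n : ℕ) (P : ℤ[X])
    (hP : P.eval 1 ≠ 0) (h : K.hilbertSeries * (1 - PowerSeries.X) ^ n = toRatSeries P) :
    P = K.hPolynomial := by
  have h1 : P * (1 - X) ^ K.rank = K.hPolynomial * (1 - X) ^ n := by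
    apply toRatSeries_injective
    rw [map_mul, map_mul, map_pow, map_pow, map_sub, map_one, toRatSeries_X, ← h,
      ← hilbertSeries_mul]
    ring
  have hX : (1 - X : ℤ[X]) ≠ 0 := by
    intro h0
    have := congrArg (Polynomial.eval 0) h0
    simp at this
  -- If the exponents differed, one of the two polynomials would be divisible by 1-t and vanish at
  -- 1.
  rcases lt_trichotomy n K.rank with hlt | heq | hlt
  · exfalso
    obtain ⟨d, hd⟩ := Nat.exists_eq_add_of_lt hlt
    have h2 : P * (1 - X) ^ (d + 1) = K.hPolynomial := by
      refine mul_right_cancel₀ (pow_ne_zero n hX) ?_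
      rw [← h1, hd]
      ring
    apply K.eval_one_hPolynomial
    rw [← h2]
    simp
  · rw [heq] at h1
    exact mul_right_cancel₀ (pow_ne_zero _ hX) h1
  · exfalso
    obtain ⟨d, hd⟩ := Nat.exists_eq_add_of_lt hlt
    have h2 : P = K.hPolynomial * (1 - X) ^ (d + 1) := by
      refine mul_right_cancel₀ (pow_ne_zero K.rank hX) ?_
      rw [h1, hd]
      ring
    apply hP
    rw [h2]
    simp

end HilbertSeries

end AbstractSimplicialComplex

/-! ### Edgewise subdivision: maps of sum k upstairs are maps of sum rk downstairs. -/

namespace AbstractSimplicialComplex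

/-- If each `x` is related to the `g x` consecutive indices following `p x`, and each index is
related to at most one `x`, then `g x` counts the indices related to `x`. -/
theorem eq_card_related {E : Type*} [Fintype E] {k : ℕ} {g p : E → ℕ} (Q : ℕ → E → Prop)
    [∀ j, DecidablePred (Q j)] (hQ : ∀ j x y, Q j x → Q j y → x = y)
    (hp : ∀ x j, p x ≤ j → j < p x + g x → Q j x) (hk : ∀ x, g x ≠ 0 → p x + g x ≤ k)
    (hsum : ∑ x, g x = k) (x : E) : g x = ((Finset.range k).filter fun j => Q j x).card := by
  have hle : ∀ x ∈ Finset.univ, g x ≤ ((Finset.range k).filter fun j => Q j x).card := by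
    intro x _
    rcases eq_or_ne (g x) 0 with h | h
    · omega
    · calc g x = (Finset.Ico (p x) (p x + g x)).card := by simp
        _ ≤ _ := by
          refine Finset.card_le_card fun j hj => ?_
          have := Finset.mem_Ico.1 hj
          have := hk x h
          exact Finset.mem_filter.2 ⟨Finset.mem_range.2 (by omega), hp x j (by omega) (by omega)⟩
  have hge : ∑ x, ((Finset.range k).filter fun j => Q j x).card ≤ ∑ x, g x := by
    simp only [Finset.card_filter]
    rw [hsum, Finset.sum_comm]
    calc _ ≤ ∑ j ∈ Finset.range k, 1 := by
          refine Finset.sum_le_sum fun j _ => ?_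
          rw [← Finset.card_filter, Finset.card_le_one]
          intro a ha b hb
          exact hQ j a b (Finset.mem_filter.1 ha).2 (Finset.mem_filter.1 hb).2
      _ = k := by simp
  -- The counts dominate g termwise, yet their total is at most k = Σ g, so equality holds
  -- everywhere.
  exact (Finset.sum_eq_sum_iff_of_le hle).1 (le_antisymm (Finset.sum_le_sum hle) hge) x
    (Finset.mem_univ x)

/-- Hermite's identity: passing from N to N+1 drops the term ⌊N/k⌋ and adds ⌊(N+k)/k⌋ = ⌊N/k⌋ + 1.
-/
theorem sum_div_add_range {k : ℕ} (hk : 0 < k) (N : ℕ) :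
    ∑ j ∈ Finset.range k, (N + j) / k = N := by
  induction N with
  | zero =>
    refine Finset.sum_eq_zero fun j hj => ?_
    rw [zero_add, Nat.div_eq_of_lt (Finset.mem_range.1 hj)]
  | succ N ih =>
    have h1 := Finset.sum_range_succ (fun j => (N + j) / k) k
    have h2 := Finset.sum_range_succ' (fun j => (N + j) / k) k
    rw [h1, ih, Nat.add_div_right _ hk, add_zero] at h2
    have h3 : ∀ j, (N + 1 + j) / k = (N + (j + 1)) / k := fun j => by congr 1; ring
    simp only [h3]
    omega

theorem mem_or_empty_of_subset {V : Type*} (K : AbstractSimplicialComplex V) {s t : Finset V} (hst : s ⊆ t) (ht : t = ∅ ∨ t ∈ K.faces) :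
    s = ∅ ∨ s ∈ K.faces := by
  rcases s.eq_empty_or_nonempty with h | h
  · exact Or.inl h
  · rcases ht with rfl | ht
    · exact Or.inl (Finset.subset_empty.1 hst)
    · exact Or.inr ((K.isRelLowerSet_faces ht).2 hst h)

section PartialSums

variable {V : Type*} [Fintype V] (L : LinearOrder V)

/-- The sum of the values of `f` on the elements smaller than `v`. -/
def strictPartialSum (f : V → ℕ) (v : V) : ℕ := ∑ u ∈ Finset.univ.filter (fun u => u < v), f u

theorem partialSum_eq (f : V → ℕ) (v : V) : partialSum L f v = strictPartialSum L f v + f v := by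
  have : Finset.univ.filter (fun u => u ≤ v) = insert v (Finset.univ.filter fun u => u < v) := by
    ext u
    simp [le_iff_eq_or_lt]
  rw [partialSum, this, Finset.sum_insert (by simp), add_comm, strictPartialSum]

theorem partialSum_injective : Function.Injective (partialSum L) := by
  intro f g h
  funext v
  induction v using WellFoundedLT.induction with
  | ind v ih =>
    have h1 := congrFun h v
    rw [partialSum_eq, partialSum_eq] at h1
    have h2 : strictPartialSum L f v = strictPartialSum L g v :=
      Finset.sum_congr rfl fun u hu => ih u (Finset.mem_filter.1 hu).2
    omega

/-- Along a lower set the strict partial sum at v is the partial sum at its predecessor, so the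
increments telescope. Applied to φ(N) = ⌊(N+j)/k⌋, it computes partial sums and totals of
`edgewisePart`. -/
theorem sum_telescope (f : V → ℕ) {φ : ℕ → ℕ} (hφ : Monotone φ) (h0 : φ 0 = 0) (s : Finset V)
    (hs : ∀ v ∈ s, ∀ u ≤ v, u ∈ s) :
    ∑ v ∈ s, (φ (partialSum L f v) - φ (strictPartialSum L f v)) = φ (∑ v ∈ s, f v) := by
  induction s using Finset.induction_on_max with
  | empty => simp [h0]
  | insert a s ha ih =>
    have hna : a ∉ s := fun h => lt_irrefl _ (ha a h)
    have h1 : strictPartialSum L f a = ∑ v ∈ s, f v := by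
      rw [strictPartialSum]
      congr 1
      ext u
      simp only [Finset.mem_filter, Finset.mem_univ, true_and]
      constructor
      · intro hu
        exact (Finset.mem_insert.1 (hs a (Finset.mem_insert_self _ _) u hu.le)).resolve_left hu.ne
      · exact ha u
    rw [Finset.sum_insert hna, Finset.sum_insert hna, ih, partialSum_eq, h1, add_comm (f a)]
    · exact Nat.sub_add_cancel (hφ (Nat.le_add_right _ _))
    · intro v hv u hu
      refine (Finset.mem_insert.1 (hs v (Finset.mem_insert_of_mem hv) u hu)).resolve_left ?_
      rintro rfl
      exact absurd (ha v hv) (not_lt.2 hu)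

/-- The `j`-th of the `k` maps into which the edgewise subdivision decomposes `f`. -/
def edgewisePart (k : ℕ) (f : V → ℕ) (j : ℕ) (v : V) : ℕ :=
  (partialSum L f v + j) / k - (strictPartialSum L f v + j) / k

theorem monotone_add_div (k j : ℕ) : Monotone fun N => (N + j) / k :=
  fun _ _ h => Nat.div_le_div_right (Nat.add_le_add_right h _)

theorem partialSum_edgewisePart {k j : ℕ} (hj : j < k) (f : V → ℕ) (v : V) :
    partialSum L (edgewisePart L k f j) v = (partialSum L f v + j) / k := by
  refine sum_telescope L f (monotone_add_div k j) (by simp [Nat.div_eq_of_lt hj]) _ ?_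
  intro v hv u hu
  simp only [Finset.mem_filter, Finset.mem_univ, true_and] at hv ⊢
  exact hu.trans hv

theorem sum_edgewisePart {k j : ℕ} (hj : j < k) (f : V → ℕ) :
    ∑ v, edgewisePart L k f j v = (∑ v, f v + j) / k :=
  sum_telescope L f (monotone_add_div k j) (by simp [Nat.div_eq_of_lt hj]) _ (by simp)

theorem sum_range_edgewisePart {k : ℕ} (hk : 0 < k) (f : V → ℕ) (v : V) :
    ∑ j ∈ Finset.range k, edgewisePart L k f j v = f v := by
  have h1 := sum_div_add_range hk (partialSum L f v)
  have h2 := sum_div_add_range hk (strictPartialSum L f v)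
  have h3 : ∑ j ∈ Finset.range k, (edgewisePart L k f j v + (strictPartialSum L f v + j) / k) =
      ∑ j ∈ Finset.range k, (partialSum L f v + j) / k := by
    refine Finset.sum_congr rfl fun j _ => Nat.sub_add_cancel (monotone_add_div k j ?_)
    rw [partialSum_eq]
    exact Nat.le_add_right _ _
  rw [Finset.sum_add_distrib, h1, h2, partialSum_eq] at h3
  omega

theorem supp_edgewisePart_subset (k : ℕ) (f : V → ℕ) (j : ℕ) :
    supp (edgewisePart L k f j) ⊆ supp f := by
  intro v hv
  rw [mem_supp] at hv ⊢
  intro h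
  apply hv
  rw [edgewisePart, partialSum_eq, h, add_zero, Nat.sub_self]

end PartialSums

section Edgewise

variable {V : Type*} [Fintype V] (K : AbstractSimplicialComplex V)

instance (r : ℕ) : Finite (K.EdgewiseVertex r) :=
  Set.Finite.to_subtype ((finite_sum_eq r).subset fun _ hf => hf.2)

noncomputable instance (r : ℕ) : Fintype (K.EdgewiseVertex r) := Fintype.ofFinite _

variable (L : LinearOrder V) {r : ℕ}

/-- The map on the vertices of `K` obtained from one on the vertices of the edgewise subdivision. -/
noncomputable def combine (g : K.EdgewiseVertex r → ℕ) (v : V) : ℕ := ∑ e, g e * e.1 v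

theorem sum_combine (g : K.EdgewiseVertex r → ℕ) : ∑ v, K.combine g v = r * ∑ e, g e := by
  simp only [combine]
  rw [Finset.sum_comm, Finset.mul_sum]
  refine Finset.sum_congr rfl fun e _ => ?_
  rw [← Finset.mul_sum, e.2.2, mul_comm]

theorem partialSum_combine (g : K.EdgewiseVertex r → ℕ) (v : V) :
    partialSum L (K.combine g) v = ∑ e, g e * partialSum L e.1 v := by
  simp only [partialSum, combine, Finset.mul_sum]
  rw [Finset.sum_comm]

theorem combine_mem {k : ℕ} {g : K.EdgewiseVertex r → ℕ}
    (hg : g ∈ (K.edgewise L r).supportedMaps k) : K.combine g ∈ K.supportedMaps (r * k) := by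
  classical
  refine ⟨?_, by rw [sum_combine, hg.2]⟩
  have hsub : supp (K.combine g) ⊆ (supp g).biUnion fun e => supp e.1 := by
    intro v hv
    rw [mem_supp] at hv
    obtain ⟨e, -, he⟩ := Finset.exists_ne_zero_of_sum_ne_zero hv
    refine Finset.mem_biUnion.2 ⟨e, mem_supp.2 (left_ne_zero_of_mul he), ?_⟩
    exact mem_supp.2 (right_ne_zero_of_mul he)
  refine K.mem_or_empty_of_subset hsub ?_
  rcases hg.1 with h | h
  · simp [h]
  · right
    convert h.2.1

open Classical in
-- Recovers g from f = `combine g`, hence injectivity. The vertices in the support of g form a chain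
-- for pointwise comparison of ι; listing them with multiplicity from the top down, the j-th has ι
-- equal to ⌊(ι(f)+j)/k⌋.
theorem eq_card_of_mem_supportedMaps {k : ℕ} {g : K.EdgewiseVertex r → ℕ}
    (hg : g ∈ (K.edgewise L r).supportedMaps k) (x : K.EdgewiseVertex r) :
    g x = ((Finset.range k).filter fun j => ∀ v, partialSum L x.1 v =
      (partialSum L (K.combine g) v + j) / k).card := by
  set below : K.EdgewiseVertex r → K.EdgewiseVertex r → Prop := fun x e =>
    e ≠ x ∧ ∀ v, partialSum L e.1 v ≤ partialSum L x.1 v with hbelow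
  have hdiff : ∀ x e, g x ≠ 0 → g e ≠ 0 →
      (∀ v, partialSum L e.1 v ≤ partialSum L x.1 v ∧
        partialSum L x.1 v ≤ partialSum L e.1 v + 1) ∨
      (∀ v, partialSum L x.1 v ≤ partialSum L e.1 v ∧
        partialSum L e.1 v ≤ partialSum L x.1 v + 1) := by
    intro x e hx he
    have hface : supp g ∈ (K.edgewise L r).faces := by
      refine hg.1.resolve_left fun h => ?_
      have := mem_supp.2 hx
      simp [h] at this
    rcases hface.2.2 x (mem_supp.2 hx) e (mem_supp.2 he) with h | h
    · left
      intro v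
      have := h v
      simp only [Set.mem_insert_iff, Set.mem_singleton_iff] at this
      omega
    · right
      intro v
      have := h v
      simp only [Set.mem_insert_iff, Set.mem_singleton_iff] at this
      omega
  have hbound : ∀ x, (∑ e, if below x e then g e else 0) + g x ≤ k := by
    intro x
    rw [← hg.2, ← Finset.add_sum_erase _ g (Finset.mem_univ x),
      ← Finset.add_sum_erase _ _ (Finset.mem_univ x), if_neg (by simp [hbelow]), zero_add, add_comm]
    refine Nat.add_le_add_left (Finset.sum_le_sum fun e _ => ?_) _
    split_ifs <;> omega
  -- Vertices other than x have ι in {ι(x)-1, ι(x)} if below x and in {ι(x), ι(x)+1} otherwise. With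
  -- p the multiplicity below x, summing gives kι(x) - p ≤ ι(f) ≤ kι(x) + k - p - g(x), so the
  -- indices p ≤ j < p + g(x) yield x.
  refine eq_card_related (p := fun x => ∑ e, if below x e then g e else 0)
    (fun j x => ∀ v, partialSum L x.1 v = (partialSum L (K.combine g) v + j) / k) ?_ ?_
    (fun x _ => hbound x) hg.2 x
  · intro j x y hx hy
    refine Subtype.ext (partialSum_injective L (funext fun v => ?_))
    rw [hx, hy]
  · intro x j hj hj' v
    have hx : g x ≠ 0 := by omega
    have hk := hbound x
    have h1 : k * partialSum L x.1 v ≤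
        partialSum L (K.combine g) v + ∑ e, if below x e then g e else 0 := by
      rw [partialSum_combine, ← hg.2, Finset.sum_mul, ← Finset.sum_add_distrib]
      refine Finset.sum_le_sum fun e _ => ?_
      rcases eq_or_ne (g e) 0 with he | he
      · simp [he]
      by_cases hb : below x e
      · rw [if_pos hb]
        have : partialSum L x.1 v ≤ partialSum L e.1 v + 1 := by
          rcases hdiff x e hx he with h | h
          · exact (h v).2
          · have := (h v).1
            omega
        calc g e * partialSum L x.1 v ≤ g e * (partialSum L e.1 v + 1) :=
              Nat.mul_le_mul_left _ this
          _ = _ := by ring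
      · rw [if_neg hb, add_zero]
        refine Nat.mul_le_mul_left _ ?_
        rcases eq_or_ne e x with rfl | hne
        · exact le_rfl
        · rcases hdiff x e hx he with h | h
          · exact absurd ⟨hne, fun v => (h v).1⟩ hb
          · exact (h v).1
    have h2 : partialSum L (K.combine g) v + ((∑ e, if below x e then g e else 0) + g x) ≤
        k * partialSum L x.1 v + k := by
      have hgx : g x = ∑ e, if e = x then g e else 0 := by simp
      rw [partialSum_combine, hgx, ← hg.2, Finset.sum_mul, ← Finset.sum_add_distrib,
        ← Finset.sum_add_distrib, ← Finset.sum_add_distrib]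
      refine Finset.sum_le_sum fun e _ => ?_
      rcases eq_or_ne (g e) 0 with he | he
      · simp [he]
      rcases eq_or_ne e x with rfl | hne
      · rw [if_neg (by simp [hbelow]), if_pos rfl, zero_add]
      · rw [if_neg hne, add_zero]
        by_cases hb : below x e
        · rw [if_pos hb]
          exact Nat.add_le_add_right (Nat.mul_le_mul_left _ (hb.2 v)) _
        · rw [if_neg hb, add_zero]
          have : partialSum L e.1 v ≤ partialSum L x.1 v + 1 := by
            rcases hdiff x e hx he with h | h
            · have := (h v).1
              omega
            · exact (h v).2
          calc g e * partialSum L e.1 v ≤ g e * (partialSum L x.1 v + 1) :=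
                Nat.mul_le_mul_left _ this
            _ = _ := by ring
    symm
    refine Nat.div_eq_of_lt_le ?_ ?_
    · rw [mul_comm]
      omega
    · rw [Nat.succ_mul, mul_comm]
      omega

open Classical in
theorem ncard_supportedMaps_edgewise (hr : 0 < r) (k : ℕ) :
    ((K.edgewise L r).supportedMaps k).ncard = (K.supportedMaps (r * k)).ncard := by
  refine Set.ncard_congr (fun g _ => K.combine g) (fun g hg => K.combine_mem L hg) ?_ ?_
  · intro g g' hg hg' h
    funext x
    rw [K.eq_card_of_mem_supportedMaps L hg, K.eq_card_of_mem_supportedMaps L hg', h]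
  · rintro f ⟨hf, hsum⟩
    have hpart : ∀ j, j < k → ∑ v, edgewisePart L k f j v = r := by
      intro j hj
      rw [sum_edgewisePart L hj, hsum, mul_comm, Nat.mul_add_div (by omega), Nat.div_eq_of_lt hj, add_zero]
    have hface : ∀ j, j < k → supp (edgewisePart L k f j) ∈ K.faces := by
      intro j hj
      refine (K.mem_or_empty_of_subset (supp_edgewisePart_subset L k f j) hf).resolve_left ?_
      intro h
      have h1 := hpart j hj
      rw [Finset.sum_eq_zero] at h1
      · omega
      · intro v _
        by_contra hv
        have := mem_supp.2 hv
        simp [h] at this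
    -- The preimage of f takes the k parts ⌊(ι(f)+j)/k⌋, 0 ≤ j < k, with multiplicity. Their ι
    -- increase with j and differ by at most 1; by Hermite's identity the parts add up to f.
    let e : Fin k → K.EdgewiseVertex r := fun j =>
      ⟨edgewisePart L k f j, hface j j.2, hpart j j.2⟩
    have hsumg : ∀ h : K.EdgewiseVertex r → ℕ,
        ∑ x, (Finset.univ.filter fun j => e j = x).card * h x = ∑ j, h (e j) := by
      intro h
      rw [← Finset.sum_fiberwise Finset.univ e]
      refine Finset.sum_congr rfl fun x _ => ?_
      rw [← smul_eq_mul, ← Finset.sum_const]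
      refine Finset.sum_congr rfl fun j hj => ?_
      rw [(Finset.mem_filter.1 hj).2]
    have hmem : ∀ x, x ∈ supp (fun x => (Finset.univ.filter fun j => e j = x).card) ↔
        ∃ j, e j = x := by
      intro x
      rw [mem_supp, Finset.card_ne_zero]
      constructor
      · rintro ⟨j, hj⟩
        exact ⟨j, (Finset.mem_filter.1 hj).2⟩
      · rintro ⟨j, hj⟩
        exact ⟨j, Finset.mem_filter.2 ⟨Finset.mem_univ _, hj⟩⟩
    refine ⟨fun x => (Finset.univ.filter fun j => e j = x).card, ⟨?_, ?_⟩, ?_⟩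
    · rcases Finset.eq_empty_or_nonempty
        (supp (fun x => (Finset.univ.filter fun j => e j = x).card)) with h | h
      · exact Or.inl h
      right
      refine ⟨h, ?_, ?_⟩
      · obtain ⟨x, hx⟩ := h
        refine (K.mem_or_empty_of_subset (t := supp f) ?_ hf).resolve_left ?_
        · intro v hv
          obtain ⟨y, hy, hv⟩ := Finset.mem_biUnion.1 hv
          obtain ⟨j, rfl⟩ := (hmem y).1 hy
          exact supp_edgewisePart_subset L k f j hv
        · intro h0
          obtain ⟨v, hv⟩ := (K.isRelLowerSet_faces x.2.1).1
          have : v ∈ Finset.biUnion _ (fun y : K.EdgewiseVertex r => supp y.1) := Finset.mem_biUnion.2 ⟨x, hx, hv⟩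
          rw [h0] at this
          simp at this
      · intro x hx y hy
        obtain ⟨i, rfl⟩ := (hmem x).1 hx
        obtain ⟨j, rfl⟩ := (hmem y).1 hy
        have hstep : ∀ i j : Fin k, i ≤ j → ∀ v,
            (partialSum L (e j).1 v : ℤ) - partialSum L (e i).1 v ∈ ({0, 1} : Set ℤ) := by
          intro i j hij v
          change (partialSum L (edgewisePart L k f j) v : ℤ) -
            partialSum L (edgewisePart L k f i) v ∈ ({0, 1} : Set ℤ)
          rw [partialSum_edgewisePart L j.2, partialSum_edgewisePart L i.2]
          have h1 : (partialSum L f v + i) / k ≤ (partialSum L f v + j) / k :=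
            Nat.div_le_div_right (Nat.add_le_add_left hij _)
          have h2 : (partialSum L f v + j) / k ≤ (partialSum L f v + i) / k + 1 := by
            rw [← Nat.add_div_right _ (by omega)]
            exact Nat.div_le_div_right (by omega)
          simp only [Set.mem_insert_iff, Set.mem_singleton_iff]
          omega
        rcases le_total i j with h | h
        · exact Or.inr (hstep i j h)
        · exact Or.inl (hstep j i h)
    · have := hsumg fun _ => 1
      simpa using this
    · funext v
      rw [combine, hsumg fun x => x.1 v]
      rcases Nat.eq_zero_or_pos k with rfl | hk
      · rw [mul_zero, Finset.sum_eq_zero_iff] at hsum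
        rw [hsum v (Finset.mem_univ v)]
        simp
      · rw [← sum_range_edgewisePart L hk f v, ← Fin.sum_univ_eq_sum_range
          fun j => edgewisePart L k f j v]

end Edgewise

end AbstractSimplicialComplex

/-! ### Counting multichains in the barycentric subdivision. -/

namespace AbstractSimplicialComplex

section Barycentric

variable {n : ℕ}

theorem supp_barycentric_iff {f : SimplexFace n → ℕ} :
    (supp f = ∅ ∨ supp f ∈ (barycentricSimplex n).faces) ↔
      ∀ s t : SimplexFace n, f s ≠ 0 → f t ≠ 0 → s.1 ⊆ t.1 ∨ t.1 ⊆ s.1 := by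
  constructor
  · rintro (h | h) s t hs ht
    · have := mem_supp.2 hs
      simp [h] at this
    · exact h.2 s (mem_supp.2 hs) t (mem_supp.2 ht)
  · intro h
    rcases (supp f).eq_empty_or_nonempty with h0 | h0
    · exact Or.inl h0
    · exact Or.inr ⟨h0, fun s hs t ht => h s t (mem_supp.1 hs) (mem_supp.1 ht)⟩

/-- The sum of the values of a map on the subsets containing a given element. -/
def coverSum (f : SimplexFace n → ℕ) (a : Fin n) : ℕ :=
  ∑ s : SimplexFace n, if a ∈ s.1 then f s else 0

theorem coverSum_le (f : SimplexFace n → ℕ) (a : Fin n) : coverSum f a ≤ ∑ s, f s := by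
  refine Finset.sum_le_sum fun s _ => ?_
  split_ifs <;> omega

theorem exists_coverSum_eq (hn : 0 < n) {f : SimplexFace n → ℕ}
    (hf : ∀ s t : SimplexFace n, f s ≠ 0 → f t ≠ 0 → s.1 ⊆ t.1 ∨ t.1 ⊆ s.1) :
    ∃ a, coverSum f a = ∑ s, f s := by
  rcases (supp f).eq_empty_or_nonempty with h | h
  · refine ⟨⟨0, hn⟩, Finset.sum_congr rfl fun s _ => ?_⟩
    have : f s = 0 := by
      by_contra h0
      have := mem_supp.2 h0
      simp [h] at this
    simp [this]
  · obtain ⟨s, hs, hmin⟩ := Finset.exists_min_image (supp f) (fun s => s.1.card) h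
    obtain ⟨a, ha⟩ := s.2
    refine ⟨a, Finset.sum_congr rfl fun t _ => ?_⟩
    rcases eq_or_ne (f t) 0 with h0 | h0
    · simp [h0]
    · rw [if_pos]
      rcases hf s t (mem_supp.1 hs) h0 with h1 | h1
      · exact h1 ha
      · rw [Finset.eq_of_subset_of_card_le h1 (hmin t (mem_supp.2 h0))]
        exact ha

open Classical in
-- A chain with multiplicities is recovered from its cover sums: its members are the superlevel sets
-- {a | coverSum f a > j}. The j assigned to s start at the total multiplicity of the strict
-- supersets of s.
theorem eq_card_of_chain {k : ℕ} {f : SimplexFace n → ℕ}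
    (hf : ∀ s t : SimplexFace n, f s ≠ 0 → f t ≠ 0 → s.1 ⊆ t.1 ∨ t.1 ⊆ s.1)
    (hk : ∑ s, f s = k) (s : SimplexFace n) :
    f s = ((Finset.range k).filter fun j => ∀ a, a ∈ s.1 ↔ j < coverSum f a).card := by
  have heq : ∀ s : SimplexFace n, (∑ t, if s.1 ⊂ t.1 then f t else 0) + f s =
      ∑ t, if s.1 ⊆ t.1 then f t else 0 := by
    intro s
    have h1 : f s = ∑ t, if t = s then f t else 0 := by simp
    rw [h1, ← Finset.sum_add_distrib]
    refine Finset.sum_congr rfl fun t _ => ?_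
    rcases eq_or_ne t s with rfl | hne
    · simp
    · rw [if_neg hne, add_zero]
      refine if_congr ?_ rfl rfl
      rw [Finset.ssubset_iff_subset_ne]
      exact and_iff_left fun h => hne (Subtype.ext h.symm)
  refine eq_card_related (p := fun s => ∑ t, if s.1 ⊂ t.1 then f t else 0)
    (fun j s => ∀ a, a ∈ s.1 ↔ j < coverSum f a) ?_ ?_ ?_ hk s
  · intro j s t hs ht
    exact Subtype.ext (Finset.ext fun a => (hs a).trans (ht a).symm)
  · intro s j hj hj' a
    have hs : f s ≠ 0 := by omega
    constructor
    · intro ha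
      refine hj'.trans_le ?_
      rw [heq]
      refine Finset.sum_le_sum fun t _ => ?_
      by_cases h : s.1 ⊆ t.1
      · rw [if_pos h, if_pos (h ha)]
      · simp [h]
    · intro hlt
      by_contra ha
      refine absurd (hlt.trans_le ?_) (not_lt.2 hj)
      refine Finset.sum_le_sum fun t _ => ?_
      split_ifs with h1 h2 h2
      · exact le_rfl
      · by_contra h0
        rcases hf s t hs (by omega) with h | h
        · exact h2 ⟨h, fun h' => ha (h' h1)⟩
        · exact ha (h h1)
      · exact Nat.zero_le _
      · exact le_rfl
  · intro s _
    rw [heq, ← hk]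
    refine Finset.sum_le_sum fun t _ => ?_
    split_ifs <;> omega

open Classical in
-- Cover sums biject multichains of k nonempty subsets with functions on [n] bounded by k that
-- attain k; an element of the smallest set attains it. Such functions number (k+1)^n - k^n.
theorem ncard_supportedMaps_barycentricSimplex (hn : 0 < n) (k : ℕ) :
    ((barycentricSimplex n).supportedMaps k).ncard = (k + 1) ^ n - k ^ n := by
  have hcard : ((Fintype.piFinset fun _ : Fin n => Finset.range (k + 1)) \
      Fintype.piFinset fun _ => Finset.range k).card = (k + 1) ^ n - k ^ n := by
    rw [Finset.card_sdiff_of_subset (Fintype.piFinset_subset _ _ fun _ =>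
      Finset.range_subset_range.2 (Nat.le_succ k))]
    simp
  rw [← hcard, ← Set.ncard_coe_finset]
  have hmem : ∀ y : Fin n → ℕ, y ∈ ((((Fintype.piFinset fun _ : Fin n => Finset.range (k + 1)) \
      Fintype.piFinset fun _ => Finset.range k) : Finset (Fin n → ℕ)) : Set (Fin n → ℕ)) ↔
      (∀ a, y a ≤ k) ∧ ∃ a, k ≤ y a := by
    intro y
    simp
  refine Set.ncard_congr (fun f _ => coverSum f) ?_ ?_ ?_
  · rintro f ⟨hf, hsum⟩
    rw [hmem]
    obtain ⟨a, ha⟩ := exists_coverSum_eq hn (supp_barycentric_iff.1 hf)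
    exact ⟨fun b => hsum ▸ coverSum_le f b, a, by rw [ha, hsum]⟩
  · rintro f f' ⟨hf, hsum⟩ ⟨hf', hsum'⟩ h
    funext s
    rw [eq_card_of_chain (supp_barycentric_iff.1 hf) hsum,
      eq_card_of_chain (supp_barycentric_iff.1 hf') hsum', h]
  · intro y hy
    rw [hmem] at hy
    obtain ⟨hle, b, hb⟩ := hy
    -- The superlevel sets of y; they are nonempty because b, where y reaches k, lies in all of
    -- them.
    let e : Fin k → SimplexFace n := fun j =>
      ⟨Finset.univ.filter fun a => (j : ℕ) < y a, b, by
        simp only [Finset.mem_filter, Finset.mem_univ, true_and]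
        omega⟩
    have he : ∀ j a, a ∈ (e j).1 ↔ (j : ℕ) < y a := fun j a => by simp [e]
    have hsumg : ∀ h : SimplexFace n → ℕ,
        ∑ x, (Finset.univ.filter fun j => e j = x).card * h x = ∑ j, h (e j) := by
      intro h
      rw [← Finset.sum_fiberwise Finset.univ e]
      refine Finset.sum_congr rfl fun x _ => ?_
      rw [← smul_eq_mul, ← Finset.sum_const]
      refine Finset.sum_congr rfl fun j hj => ?_
      rw [(Finset.mem_filter.1 hj).2]
    refine ⟨fun x => (Finset.univ.filter fun j => e j = x).card,
      ⟨supp_barycentric_iff.2 ?_, ?_⟩, ?_⟩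
    · intro s t hs ht
      obtain ⟨i, hi⟩ := Finset.card_ne_zero.1 hs
      obtain ⟨j, hj⟩ := Finset.card_ne_zero.1 ht
      obtain rfl := (Finset.mem_filter.1 hi).2
      obtain rfl := (Finset.mem_filter.1 hj).2
      rcases le_total i j with h | h
      · right
        intro a ha
        rw [he] at ha ⊢
        exact lt_of_le_of_lt h ha
      · left
        intro a ha
        rw [he] at ha ⊢
        exact lt_of_le_of_lt h ha
    · have := hsumg fun _ => 1
      simpa using this
    · funext a
      have := hsumg fun s => if a ∈ s.1 then 1 else 0
      simp only [mul_ite, mul_one, mul_zero, he] at this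
      rw [coverSum, this, Fin.sum_univ_eq_sum_range (fun j => if j < y a then 1 else 0),
        ← Finset.card_filter]
      have hr : (Finset.range k).filter (fun j => j < y a) = Finset.range (y a) := by
        ext j
        have := hle a
        simp only [Finset.mem_filter, Finset.mem_range]
        omega
      rw [hr, Finset.card_range]

end Barycentric

end AbstractSimplicialComplex

/-! ### Assembly of the three statements. -/

section Main

theorem hilbertSeries_edgewiseBarycentric {n r : ℕ} (hn : 0 < n) (hr : 0 < r)
    (L : LinearOrder (SimplexFace n)) :
    (edgewiseBarycentric n r L).hilbertSeries =
      PowerSeries.mk fun k : ℕ => ((r : ℚ) * k + 1) ^ n - ((r : ℚ) * k) ^ n := by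
  ext k
  rw [AbstractSimplicialComplex.hilbertSeries, PowerSeries.coeff_mk, PowerSeries.coeff_mk,
    edgewiseBarycentric, AbstractSimplicialComplex.ncard_supportedMaps_edgewise _ L hr,
    AbstractSimplicialComplex.ncard_supportedMaps_barycentricSimplex hn,
    Nat.cast_sub (Nat.pow_le_pow_left (Nat.le_succ _) n)]
  push_cast
  rfl

theorem eval_one_desSumFirstZero_ne_zero (n : ℕ) {r : ℕ} (hr : 0 < r) :
    (∑ w : ColoredPerm n r with w.FirstColorZero, (X : ℤ[X]) ^ w.des).eval 1 ≠ 0 := by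
  simp only [eval_finsetSum, eval_pow, eval_X, one_pow, Finset.sum_const, nsmul_eq_mul, mul_one]
  rw [Nat.cast_ne_zero, Finset.card_ne_zero]
  exact ⟨(1, fun _ => ⟨0, hr⟩), Finset.mem_filter.2 ⟨Finset.mem_univ _, fun _ _ => rfl⟩⟩

theorem proposition5p1 (n r : ℕ) (hn : 0 < n) (hr : 0 < r) :
    -- (a), for every linear order on the vertices of the barycentric subdivision
    (∀ L : LinearOrder (SimplexFace n), APlus n r = (edgewiseBarycentric n r L).hPolynomial) ∧
    -- (b), an identity of formal power series over `ℚ`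
    ((((APlus n r).map (Int.castRingHom ℚ) : ℚ[X]) : PowerSeries ℚ) *
        ((1 - PowerSeries.X) ^ n)⁻¹ =
      PowerSeries.mk fun k : ℕ => ((r : ℚ) * k + 1) ^ n - ((r : ℚ) * k) ^ n) ∧
    -- (c), first equality
    (APlus n r = ∑ w : ColoredPerm n r with w.FirstColorZero, X ^ w.des) ∧
    -- (c), second equality; the division is exact, since `r` divides the flag excedance number
    (APlus n r = ∑ w : ColoredPerm n r with r ∣ w.colorSum, X ^ (w.fexc / r)) := by
  have h1 : APlus n r = ∑ w : ColoredPerm n r with w.FirstColorZero, X ^ w.des :=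
    toRatSeries_injective ((toRatSeries_APlus n hr).trans (toRatSeries_desSumFirstZero n hr).symm)
  refine ⟨fun L => ?_, toRatSeries_mul_inv n hn hr, h1,
    toRatSeries_injective ((toRatSeries_APlus n hr).trans (toRatSeries_fexcSum hn hr).symm)⟩
  refine AbstractSimplicialComplex.hPolynomial_eq_of_hilbertSeries _ n _ ?_ ?_
  -- Nonvanishing at 1 is read off the descent formula, whose value there counts a nonempty set.
  · rw [h1]
    exact eval_one_desSumFirstZero_ne_zero n hr
  · rw [hilbertSeries_edgewiseBarycentric hn hr L, toRatSeries_APlus n hr,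
      eulerianSeries_of_pos r hn, mul_comm]

end Main
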